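/- **Theorem (Strauss-type lemma for Bessel–Orlicz potential spaces).** *Setting.* A Young function is a convex, strictly increasing $A:[0,\infty)\to[0,\infty)$ with $A(0)=0$, $\lim_{t\to0^+}A(t)/t=0$ and $\lim_{t\to\infty}A(t)/t=\infty$; $a$ denotes its right derivative and $\hat A(t)=\sup_{w>0}(tw-A(w))$, $t\ge 0$, its complementary function, whose inverse on $[0,\infty)$ is $\hat A^{-1}$. A function $B$ satisfies $\Delta_2$ if there is a constant $K$ with $B(2t)\le K\,B(t)$ for all $t\ge0$. $L^A(\mathbb R^n)$ is the set of measurable $u:\mathbb R^n\to\mathbb R$ with $\int_{\mathbb R^n} A(|u|)\,dx<\infty$, and $\|u\|_{L^A}=\inf\{\lambda>0:\int_{\mathbb R^n} A(|u|/\lambda)\,dx\le1\}$. For $s>0$ let $G_s\in L^1(\mathbb R^n)$ be the Bessel kernel, i.e. the function with $\int_{\mathbb R^n} e^{-i x\cdot\xi}G_s(x)\,dx=(1+|\xi|^2)^{-s/2}$, given for $x\ne0$ by $$G_s(x)=\frac{1}{(4\pi)^{n/2}\Gamma(s/2)}\int_0^\infty e^{-t-|x|^2/(4t)}\,t^{(s-n)/2-1}\,dt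 .$$ $H^{s,A}(\mathbb R^n)$ is the set of $u\in L^A(\mathbb R^n)$ with $u=G_s*f$ a.e. for some $f\in L^A(\mathbb R^n)$, with norm $\|u\|_{H^{s,A}}=\|f\|_{L^A}$ (under the hypotheses below, $f$ is unique up to null sets). A function $u$ is radial if $u(x)=u_0(|x|)$ for a.e. $x$, for some $u_0$. *Statement.* Let $n\ge1$, $1<p^-\le p^+<\infty$ and $s\in\mathbb R$ with $sp^->1$. There is a constant $C>0$, depending only on $n$, $s$, $p^-$ and $p^+$, such that for every Young function $A$ for which $A$ and $\hat A$ satisfy $\Delta_2$ and $$p^-\le \frac{t\,a(t)}{A(t)}\le p^+\qquad\text{for all }t>0,$$ and every radial $u\in H^{s,A}(\mathbb R^n)$, $$|u(x)|\le C\,\frac{|x|^{1-n}}{\hat A^{-1}(|x|^{1-n})}\,\|u\|_{H^{s,A}(\mathbb R^n)}\qquad\text{for a.e. }x\in\mathbb R^n .$$ Moreover, for every $f\in L^A(\mathbb R^n)$ with $u=G_s*f$ a.e., the integral $(G_s*f)(x)=\int_{\mathbb R^n}G_s(y)f(x-y)\,dy$ converges absolutely for every $x\neq0$, and the representative $G_s*f$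 of $u$ satisfies this bound at every $x\ne0$. -/

import Mathlib

open MeasureTheory Set Filter Topology

noncomputable section

namespace OrliczBessel

/-! ### Young functions -/

/-- Young functions `A : [0, ∞) → [0, ∞)`, given as real functions of which only the values on
`[0, ∞)` are used: convex, (strictly) increasing, `A 0 = 0`, superlinear at `0` and at `∞`. -/
structure IsYoung (A : ℝ → ℝ) : Prop where
  convexOn : ConvexOn ℝ (Ici 0) A
  strictMonoOn : StrictMonoOn A (Ici 0)
  map_zero : A 0 = 0
  tendsto_div_zero : Tendsto (fun t => A t / t) (𝓝[>] 0) (𝓝 0)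
  tendsto_div_atTop : Tendsto (fun t => A t / t) atTop atTop

/-- The complementary function `Â(t) = sup {t w - A(w) : w > 0}` (for `t ≥ 0`). -/
def conj (A : ℝ → ℝ) (t : ℝ) : ℝ := sSup ((fun w => t * w - A w) '' Ioi 0)

/-- The `Δ₂`-condition on `[0, ∞)`. -/
def DeltaTwo (A : ℝ → ℝ) : Prop := ∃ C : ℝ, ∀ t : ℝ, 0 ≤ t → A (2 * t) ≤ C * A t

/-- The right derivative, which for a Young function `A` is the right-continuous density `a` in
the representation `A(t) = ∫₀ᵗ a(τ) dτ`. -/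
def rightDeriv (A : ℝ → ℝ) (t : ℝ) : ℝ := derivWithin A (Ioi t) t

/-- The growth condition `p⁻ ≤ t a(t) / A(t) ≤ p⁺` for all `t > 0`. -/
def HasGrowth (A : ℝ → ℝ) (pm pp : ℝ) : Prop :=
  ∀ t : ℝ, 0 < t → pm ≤ t * rightDeriv A t / A t ∧ t * rightDeriv A t / A t ≤ pp

/-- The inverse function `[0, ∞) → [0, ∞)` of the restriction of `B` to `[0, ∞)`. -/
def invHalfLine (B : ℝ → ℝ) : ℝ → ℝ := Function.invFunOn B (Ici 0)

/-! ### Orlicz spaces on `ℝⁿ` -/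

/-- The modular `Φ_A(u) = ∫ A(|u|) dx ∈ [0, ∞]`. -/
def modular {n : ℕ} (A : ℝ → ℝ) (u : EuclideanSpace ℝ (Fin n) → ℝ) : ENNReal :=
  ∫⁻ x, ENNReal.ofReal (A |u x|)

/-- `u ∈ L^A(ℝⁿ)`. -/
def MemOrlicz {n : ℕ} (A : ℝ → ℝ) (u : EuclideanSpace ℝ (Fin n) → ℝ) : Prop :=
  AEStronglyMeasurable u volume ∧ modular A u < ⊤

/-- The Luxemburg norm `inf {λ > 0 : Φ_A(u / λ) ≤ 1}`. -/
def luxemburgNorm {n : ℕ} (A : ℝ → ℝ) (u : EuclideanSpace ℝ (Fin n) → ℝ) : ℝ :=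
  sInf {l : ℝ | 0 < l ∧ modular A (fun x => u x / l) ≤ 1}

/-! ### Bessel kernels -/

/-- The Bessel kernel of order `s > 0` on `ℝⁿ`,
`G_s(x) = ((4π)^{n/2} Γ(s/2))⁻¹ ∫₀^∞ exp(-t - |x|²/(4t)) t^{(s-n)/2 - 1} dt`. The theorems
`integrable_besselKernel` and `fourier_besselKernel` below show that it is the integrable function
with Fourier transform `(1 + |ξ|²)^{-s/2}`. -/
def besselKernel (n : ℕ) (s : ℝ) (x : EuclideanSpace ℝ (Fin n)) : ℝ :=
  ((4 * Real.pi) ^ ((n : ℝ) / 2) * Real.Gamma (s / 2))⁻¹ *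
    ∫ t in Ioi (0 : ℝ), Real.exp (-t - ‖x‖ ^ 2 / (4 * t)) * t ^ ((s - n) / 2 - 1)

theorem meas_aux (n : ℕ) (s : ℝ) : Measurable
    (fun p : EuclideanSpace ℝ (Fin n) × ℝ =>
      Real.exp (-p.2 - ‖p.1‖ ^ 2 / (4 * p.2)) * p.2 ^ ((s - n) / 2 - 1)) := by
  fun_prop

theorem gauss_aux (n : ℕ) {t : ℝ} (ht : 0 < t) (ξ : EuclideanSpace ℝ (Fin n)) :
    Integrable (fun x : EuclideanSpace ℝ (Fin n) =>
      Complex.exp (-((1 / (4 * t) : ℝ) : ℂ) * ‖x‖ ^ 2 + (-Complex.I) * (inner ℝ ξ x : ℝ))) ∧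
    ∫ x : EuclideanSpace ℝ (Fin n),
      Complex.exp (-((1 / (4 * t) : ℝ) : ℂ) * ‖x‖ ^ 2 + (-Complex.I) * (inner ℝ ξ x : ℝ)) =
      (((4 * Real.pi * t) ^ ((n : ℝ) / 2) * Real.exp (-t * ‖ξ‖ ^ 2) : ℝ) : ℂ) := by
  have hb : 0 < (((1 / (4 * t) : ℝ) : ℂ)).re := by
    rw [Complex.ofReal_re]; positivity
  refine ⟨GaussianFourier.integrable_cexp_neg_mul_sq_norm_add hb _ ξ, ?_⟩
  rw [GaussianFourier.integral_cexp_neg_mul_sq_norm_add hb]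
  have h1 : (Real.pi / ((1 / (4 * t) : ℝ) : ℂ) : ℂ) = ((4 * Real.pi * t : ℝ) : ℂ) := by
    have : (t : ℂ) ≠ 0 := by exact_mod_cast ht.ne'
    push_cast; field_simp
  have h2 : ((-Complex.I) ^ 2 * (‖ξ‖ : ℂ) ^ 2 / (4 * ((1 / (4 * t) : ℝ) : ℂ)) : ℂ) =
      ((-t * ‖ξ‖ ^ 2 : ℝ) : ℂ) := by
    have : (t : ℂ) ≠ 0 := by exact_mod_cast ht.ne'
    push_cast; field_simp; simp
  rw [h1, h2, finrank_euclideanSpace, Fintype.card_fin]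
  have h3 : (0 : ℝ) ≤ 4 * Real.pi * t := by positivity
  rw [Complex.ofReal_mul ((4 * Real.pi * t) ^ ((n : ℝ) / 2)), Complex.ofReal_cpow h3,
    Complex.ofReal_exp]
  push_cast
  rfl

theorem gauss_real_aux (n : ℕ) {t : ℝ} (ht : 0 < t) :
    Integrable (fun x : EuclideanSpace ℝ (Fin n) => Real.exp (-(‖x‖ ^ 2 / (4 * t)))) ∧
    ∫ x : EuclideanSpace ℝ (Fin n), Real.exp (-(‖x‖ ^ 2 / (4 * t))) =
      (4 * Real.pi * t) ^ ((n : ℝ) / 2) := by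
  obtain ⟨h1, h2⟩ := gauss_aux n ht 0
  have h3 : ∀ x : EuclideanSpace ℝ (Fin n),
      Complex.exp (-((1 / (4 * t) : ℝ) : ℂ) * ‖x‖ ^ 2 +
        (-Complex.I) * (inner ℝ (0 : EuclideanSpace ℝ (Fin n)) x : ℝ)) =
      ((Real.exp (-(‖x‖ ^ 2 / (4 * t))) : ℝ) : ℂ) := by
    intro x
    rw [inner_zero_left]
    push_cast
    congr 1
    ring
  simp only [h3] at h1 h2
  refine ⟨?_, ?_⟩
  · have h4 := h1.re
    simp only [RCLike.re_eq_complex_re, Complex.ofReal_re] at h4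
    exact h4
  rw [integral_complex_ofReal] at h2
  have := Complex.ofReal_injective h2
  simpa using this

theorem rpow_aux (n : ℕ) (s : ℝ) {t : ℝ} (ht : 0 < t) :
    (4 * Real.pi * t) ^ ((n : ℝ) / 2) * t ^ ((s - n) / 2 - 1) =
      (4 * Real.pi) ^ ((n : ℝ) / 2) * t ^ (s / 2 - 1) := by
  rw [Real.mul_rpow (by positivity) ht.le, mul_assoc, ← Real.rpow_add ht]
  congr 2
  ring

theorem prod_aux (n : ℕ) {s : ℝ} (hs : 0 < s) : Integrable
    (fun p : EuclideanSpace ℝ (Fin n) × ℝ =>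
      Real.exp (-p.2 - ‖p.1‖ ^ 2 / (4 * p.2)) * p.2 ^ ((s - n) / 2 - 1))
    (volume.prod (volume.restrict (Ioi 0))) := by
  rw [integrable_prod_iff' (meas_aux n s).aestronglyMeasurable]
  have key : ∀ (t : ℝ) (x : EuclideanSpace ℝ (Fin n)),
      Real.exp (-t - ‖x‖ ^ 2 / (4 * t)) * t ^ ((s - n) / 2 - 1) =
      (Real.exp (-t) * t ^ ((s - n) / 2 - 1)) * Real.exp (-(‖x‖ ^ 2 / (4 * t))) := by
    intro t x
    rw [sub_eq_add_neg, Real.exp_add]; ring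
  constructor
  · filter_upwards [ae_restrict_mem measurableSet_Ioi] with t ht
    simp only [key]
    exact (gauss_real_aux n ht).1.const_mul _
  · have h := (Real.GammaIntegral_convergent (half_pos hs)).const_mul
      ((4 * Real.pi) ^ ((n : ℝ) / 2))
    refine h.congr ?_
    filter_upwards [ae_restrict_mem measurableSet_Ioi] with t ht
    have ht' : 0 < t := ht
    have h4 : ∀ x : EuclideanSpace ℝ (Fin n),
        ‖Real.exp (-t - ‖x‖ ^ 2 / (4 * t)) * t ^ ((s - n) / 2 - 1)‖ =
        (Real.exp (-t) * t ^ ((s - n) / 2 - 1)) * Real.exp (-(‖x‖ ^ 2 / (4 * t))) := by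
      intro x
      rw [Real.norm_of_nonneg (by positivity), key]
    simp only [h4]
    rw [integral_const_mul, (gauss_real_aux n ht').2]
    have := rpow_aux n s ht'
    calc _ = Real.exp (-t) * ((4 * Real.pi) ^ ((n : ℝ) / 2) * t ^ (s / 2 - 1)) := by ring
      _ = _ := by rw [← this]; ring

theorem integrable_besselKernel (n : ℕ) {s : ℝ} (hs : 0 < s) :
    Integrable (besselKernel n s) :=
  (prod_aux n hs).integral_prod_left.const_mul _

theorem fourier_besselKernel (n : ℕ) {s : ℝ} (hs : 0 < s) (ξ : EuclideanSpace ℝ (Fin n)) :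
    ∫ x, Complex.exp (-Complex.I * (inner ℝ ξ x : ℝ)) * (besselKernel n s x : ℂ) =
      (((1 + ‖ξ‖ ^ 2) ^ (-s / 2) : ℝ) : ℂ) := by
  set F : EuclideanSpace ℝ (Fin n) → ℝ → ℂ := fun x t =>
    Complex.exp (-Complex.I * (inner ℝ ξ x : ℝ)) *
      ((Real.exp (-t - ‖x‖ ^ 2 / (4 * t)) * t ^ ((s - n) / 2 - 1) : ℝ) : ℂ) with hF
  have hint : Integrable (Function.uncurry F) (volume.prod (volume.restrict (Ioi 0))) := by
    have h0 := (prod_aux n hs).ofReal (𝕜 := ℂ)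
    refine h0.bdd_mul (c := 1)
      (f := fun p : EuclideanSpace ℝ (Fin n) × ℝ =>
        Complex.exp (-Complex.I * (inner ℝ ξ p.1 : ℝ))) ?_ ?_
    · exact Continuous.aestronglyMeasurable (by fun_prop)
    · refine ae_of_all _ fun p => ?_
      rw [Complex.norm_exp]
      simp
  have hc : ∀ x : EuclideanSpace ℝ (Fin n),
      Complex.exp (-Complex.I * (inner ℝ ξ x : ℝ)) * (besselKernel n s x : ℂ) =
      ((((4 * Real.pi) ^ ((n : ℝ) / 2) * Real.Gamma (s / 2))⁻¹ : ℝ) : ℂ) *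
        ∫ t in Ioi (0 : ℝ), F x t := by
    intro x
    simp only [hF, besselKernel]
    rw [integral_const_mul, integral_complex_ofReal, Complex.ofReal_mul]
    ring
  simp only [hc]
  rw [integral_const_mul, integral_integral_swap hint]
  have hin : ∀ t ∈ Ioi (0 : ℝ), ∫ x, F x t =
      (((4 * Real.pi) ^ ((n : ℝ) / 2) *
        (t ^ (s / 2 - 1) * Real.exp (-((1 + ‖ξ‖ ^ 2) * t))) : ℝ) : ℂ) := by
    intro t ht
    have ht' : 0 < t := ht
    have h5 : ∀ x, F x t = ((Real.exp (-t) * t ^ ((s - n) / 2 - 1) : ℝ) : ℂ) *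
        Complex.exp (-((1 / (4 * t) : ℝ) : ℂ) * ‖x‖ ^ 2 +
          (-Complex.I) * (inner ℝ ξ x : ℝ)) := by
      intro x
      simp only [hF]
      rw [Complex.exp_add, sub_eq_add_neg, Real.exp_add]
      push_cast
      rw [show (-(‖x‖ ^ 2 / (4 * t)) : ℂ) = -(1 / (4 * t)) * ‖x‖ ^ 2 by ring]
      ring
    simp only [h5]
    rw [integral_const_mul, (gauss_aux n ht' ξ).2, ← Complex.ofReal_mul]
    congr 1
    have h6 := rpow_aux n s ht'
    have h7 : Real.exp (-((1 + ‖ξ‖ ^ 2) * t)) = Real.exp (-t) * Real.exp (-t * ‖ξ‖ ^ 2) := by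
      rw [← Real.exp_add]; congr 1; ring
    rw [h7]
    calc _ = ((4 * Real.pi * t) ^ ((n : ℝ) / 2) * t ^ ((s - n) / 2 - 1)) *
          (Real.exp (-t) * Real.exp (-t * ‖ξ‖ ^ 2)) := by ring
      _ = _ := by rw [h6]; ring
  rw [setIntegral_congr_fun measurableSet_Ioi hin, integral_complex_ofReal,
    integral_const_mul, Real.integral_rpow_mul_exp_neg_mul_Ioi (half_pos hs) (by positivity),
    ← Complex.ofReal_mul]
  congr 1
  have hG : Real.Gamma (s / 2) ≠ 0 := (Real.Gamma_pos_of_pos (half_pos hs)).ne'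
  have hP : (4 * Real.pi) ^ ((n : ℝ) / 2) ≠ 0 := by positivity
  rw [one_div, Real.inv_rpow (by positivity), neg_div, Real.rpow_neg (by positivity)]
  field_simp

/-! ### Bessel-Orlicz potential spaces -/

/-- The Bessel potential `G_s * f`, `(G_s * f)(x) = ∫ G_s(y) f(x - y) dy`. -/
def besselPotential (n : ℕ) (s : ℝ) (f : EuclideanSpace ℝ (Fin n) → ℝ) :
    EuclideanSpace ℝ (Fin n) → ℝ :=
  convolution (besselKernel n s) f (ContinuousLinearMap.mul ℝ ℝ) volume

/-- `f ∈ L^A(ℝⁿ)` and `u = G_s * f` almost everywhere. -/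
def IsDensity {n : ℕ} (s : ℝ) (A : ℝ → ℝ) (u f : EuclideanSpace ℝ (Fin n) → ℝ) : Prop :=
  MemOrlicz A f ∧ u =ᵐ[volume] besselPotential n s f

/-- `u ∈ H^{s,A}(ℝⁿ)`. -/
def MemBesselOrlicz {n : ℕ} (s : ℝ) (A : ℝ → ℝ) (u : EuclideanSpace ℝ (Fin n) → ℝ) : Prop :=
  MemOrlicz A u ∧ ∃ f, IsDensity s A u f

/-- The norm `‖u‖_{H^{s,A}} = ‖f‖_{L^A}`, where `u = G_s * f` with `f ∈ L^A`. Since `f` is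
determined by `u` up to a null set, the infimum is over a single number. -/
def besselOrliczNorm {n : ℕ} (s : ℝ) (A : ℝ → ℝ) (u : EuclideanSpace ℝ (Fin n) → ℝ) : ℝ :=
  sInf {r : ℝ | ∃ f, IsDensity s A u f ∧ r = luxemburgNorm A f}

/-- `u` is radial: `u(x) = u₀(|x|)` for almost every `x`. -/
def IsRadial {n : ℕ} (u : EuclideanSpace ℝ (Fin n) → ℝ) : Prop :=
  ∃ u₀ : ℝ → ℝ, ∀ᵐ x, u x = u₀ ‖x‖

end OrliczBessel

end

/-! The density `f` of a radial `u` is rotation invariant, and averaging over rotations makes `G_s`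
behave like a one-dimensional kernel of order `t ^ (σ - 1)`, which lies in the dual Orlicz scale
once `1 / pm < σ`.

Rotation invariance rests on injectivity of `f ↦ G_s * f` (`ae_eq_of_besselPotential_ae_eq`): `f ∘
R` and `f` have the same potential a.e. Injectivity is proved by duality, since `G_s * ψ` runs
through all Schwartz functions. It also makes the infimum defining the norm of `u` equal to the
Luxemburg norm of `f`.

For the averaging, fix `1 / pm < σ < min 1 s`. The kernel is dominated by `min (|x|^(σ-n))
(|x|^(-(n+1)))`, which is written as a superposition of indicators of balls. The integral of a
rotation invariant `F ≥ 0` over `B(x, t)` is at most `2^n (t / (|x| + t))^(n-1)` times its integral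
over the shell `||z| - |x|| < 3t` (`setLIntegral_ball_le`). Summing over `t` gives `radialMajorant`
(`lintegral_besselKernel_mul_le`).

Finally, put `r = |x|` and let `T` be the point with `Â(T) = r^(1-n)`. Young's inequality is applied
to `|f| / l` and `k * radialMajorant * r^(n-1) * T`. The growth condition bounds `Â(λT)` by
`(λ^(pp') + λ^(pm')) Â(T)`, primes denoting conjugate exponents (`conj_mul_le`). In polar
coordinates the remaining integral is controlled by integrals of `decay σ |t| ^ q` over the line,
uniformly in `r` (`lintegral_decay_rpow_le`). They converge because `σ * pm > 1`. Undoing the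
scaling leaves the factor `r^(1-n) / T`. -/

noncomputable section

namespace OrliczBessel

/-! ### Young functions: consequences of the growth condition -/

namespace IsYoung

variable {A : ℝ → ℝ} {pm pp : ℝ}

theorem pos (hA : IsYoung A) {t : ℝ} (ht : 0 < t) : 0 < A t := by
  rw [← hA.map_zero]
  exact hA.strictMonoOn self_mem_Ici ht.le ht

theorem nonneg (hA : IsYoung A) {t : ℝ} (ht : 0 ≤ t) : 0 ≤ A t := by
  rw [← hA.map_zero]
  exact hA.strictMonoOn.monotoneOn self_mem_Ici ht ht

theorem mono (hA : IsYoung A) {t w : ℝ} (ht : 0 ≤ t) (h : t ≤ w) : A t ≤ A w :=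
  hA.strictMonoOn.monotoneOn ht (ht.trans h) h

theorem continuousOn (hA : IsYoung A) : ContinuousOn A (Ioi 0) :=
  (hA.convexOn.subset Ioi_subset_Ici_self (convex_Ioi 0)).continuousOn isOpen_Ioi

/-- `derivWithin` takes the value `0` where differentiability fails, and the lower growth bound
excludes that value. -/
theorem _root_.OrliczBessel.HasGrowth.hasDerivWithinAt (hg : HasGrowth A pm pp) (hpm : 1 < pm)
    {t : ℝ} (ht : 0 < t) : HasDerivWithinAt A (rightDeriv A t) (Ici t) t := by
  have h1 : derivWithin A (Ioi t) t ≠ 0 := by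
    intro h0
    have h2 := (hg t ht).1
    rw [rightDeriv, h0] at h2
    simp at h2
    linarith
  have h3 : DifferentiableWithinAt ℝ A (Ioi t) t := by
    by_contra h
    exact h1 (derivWithin_zero_of_not_differentiableWithinAt h)
  exact h3.hasDerivWithinAt.Ici_of_Ioi

theorem rpow_hasDerivWithinAt (hA : IsYoung A) (hg : HasGrowth A pm pp) (hpm : 1 < pm) (c : ℝ)
    {t : ℝ} (ht : 0 < t) :
    HasDerivWithinAt (fun t => A t * t ^ (-c))
      (t ^ (-c) * A t / t * (t * rightDeriv A t / A t - c)) (Ici t) t := by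
  have h := (hg.hasDerivWithinAt hpm ht).mul
    ((Real.hasDerivAt_rpow_const (p := -c) (Or.inl ht.ne')).hasDerivWithinAt (s := Ici t))
  refine h.congr_deriv ?_
  have := (hA.pos ht).ne'
  rw [Real.rpow_sub_one ht.ne']
  field_simp
  ring

theorem rpow_continuousOn (hA : IsYoung A) (c : ℝ) {v w : ℝ} (hv : 0 < v) :
    ContinuousOn (fun t => A t * t ^ (-c)) (Icc v w) := by
  have hsub : Icc v w ⊆ Ioi 0 := fun t ht => hv.trans_le ht.1
  refine (hA.continuousOn.mono hsub).mul fun t ht => ?_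
  exact (Real.continuousAt_rpow_const _ _ (Or.inl (hsub ht).ne')).continuousWithinAt

/-- The right derivative of `A t * t ^ (-pm)` has the sign of `t * a t / A t - pm`, so this quotient
is nondecreasing; one-sided derivatives suffice by the mean value inequality. -/
theorem mul_rpow_neg_le (hA : IsYoung A) (hg : HasGrowth A pm pp) (hpm : 1 < pm) {v w : ℝ}
    (hv : 0 < v) (hvw : v ≤ w) : A v * v ^ (-pm) ≤ A w * w ^ (-pm) := by
  refine image_le_of_deriv_right_le_deriv_boundary (f := fun _ => A v * v ^ (-pm))
    (f' := fun _ => 0) (a := v) (b := w) continuousOn_const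
    (fun x _ => hasDerivWithinAt_const _ _ _) le_rfl (hA.rpow_continuousOn pm hv)
    (fun x hx => hA.rpow_hasDerivWithinAt hg hpm pm (hv.trans_le hx.1)) (fun x hx => ?_)
    (right_mem_Icc.2 hvw)
  have hx0 := hv.trans_le hx.1
  have h1 := (hg x hx0).1
  have h2 := hA.pos hx0
  have h3 : 0 ≤ x * rightDeriv A x / A x - pm := by linarith
  positivity

theorem mul_rpow_neg_le' (hA : IsYoung A) (hg : HasGrowth A pm pp) (hpm : 1 < pm) {v w : ℝ}
    (hv : 0 < v) (hvw : v ≤ w) : A w * w ^ (-pp) ≤ A v * v ^ (-pp) := by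
  refine image_le_of_deriv_right_le_deriv_boundary (B := fun _ => A v * v ^ (-pp))
    (B' := fun _ => 0) (a := v) (b := w) (hA.rpow_continuousOn pp hv)
    (fun x hx => hA.rpow_hasDerivWithinAt hg hpm pp (hv.trans_le hx.1)) le_rfl
    continuousOn_const (fun x _ => hasDerivWithinAt_const _ _ _) (fun x hx => ?_)
    (right_mem_Icc.2 hvw)
  have hx0 := hv.trans_le hx.1
  have h1 := (hg x hx0).2
  have h2 := hA.pos hx0
  refine mul_nonpos_of_nonneg_of_nonpos (by positivity) (by linarith)

theorem rpow_mul_le (hA : IsYoung A) (hg : HasGrowth A pm pp) (hpm : 1 < pm) {l v : ℝ}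
    (hl : 1 ≤ l) (hv : 0 ≤ v) : l ^ pm * A v ≤ A (l * v) := by
  rcases hv.eq_or_lt with rfl | hv
  · simp [hA.map_zero]
  have hl0 : 0 < l := by linarith
  have h := hA.mul_rpow_neg_le hg hpm hv (le_mul_of_one_le_left hv.le hl)
  rw [Real.mul_rpow hl0.le hv.le, ← mul_assoc] at h
  have h2 := le_of_mul_le_mul_right h (by positivity)
  rw [Real.rpow_neg hl0.le, ← div_eq_mul_inv, le_div_iff₀ (by positivity)] at h2
  linarith

theorem rpow_mul_le' (hA : IsYoung A) (hg : HasGrowth A pm pp) (hpm : 1 < pm) {l v : ℝ}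
    (hl0 : 0 < l) (hl : l ≤ 1) (hv : 0 ≤ v) : l ^ pp * A v ≤ A (l * v) := by
  rcases hv.eq_or_lt with rfl | hv
  · simp [hA.map_zero]
  have h := hA.mul_rpow_neg_le' hg hpm (mul_pos hl0 hv) (mul_le_of_le_one_left hv.le hl)
  rw [Real.mul_rpow hl0.le hv.le, ← mul_assoc] at h
  have h2 := le_of_mul_le_mul_right h (by positivity)
  rw [Real.rpow_neg hl0.le, ← div_eq_mul_inv, le_div_iff₀ (by positivity)] at h2
  linarith

theorem div_le (hA : IsYoung A) (hg : HasGrowth A pm pp) (hpm : 1 < pm) {l v : ℝ}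
    (hl : 1 ≤ l) (hv : 0 ≤ v) : A (v / l) ≤ l⁻¹ * A v := by
  have hl0 : 0 < l := by linarith
  have h := hA.rpow_mul_le hg hpm hl (div_nonneg hv hl0.le)
  rw [mul_div_cancel₀ _ hl0.ne'] at h
  have h2 : l ≤ l ^ pm := by
    simpa using Real.rpow_le_rpow_of_exponent_le hl hpm.le
  have h3 := (mul_le_mul_of_nonneg_right h2 (hA.nonneg (div_nonneg hv hl0.le))).trans h
  rwa [inv_mul_eq_div, le_div_iff₀ hl0, mul_comm]

/-! ### The complementary function -/

theorem bddAbove (hA : IsYoung A) (t : ℝ) : BddAbove ((fun w => t * w - A w) '' Ioi 0) := by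
  obtain ⟨M, hM⟩ := (hA.tendsto_div_atTop.eventually_ge_atTop t).exists_forall_of_atTop
  refine ⟨|t| * |M|, ?_⟩
  rintro _ ⟨w, hw, rfl⟩
  have hw : 0 < w := hw
  have hAw := hA.pos hw
  simp only
  rcases le_total M w with h | h
  · have h1 := hM w h
    rw [le_div_iff₀ hw] at h1
    have : 0 ≤ |t| * |M| := by positivity
    linarith
  · have h1 : t * w ≤ |t| * |M| := by
      apply mul_le_mul (le_abs_self t) (h.trans (le_abs_self M)) hw.le (abs_nonneg t)
    linarith

theorem mul_le_add_conj_of_pos (hA : IsYoung A) (t : ℝ) {w : ℝ} (hw : 0 < w) :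
    t * w ≤ A w + conj A t := by
  have := le_csSup (hA.bddAbove t) ⟨w, hw, rfl⟩
  simp only [conj] at this ⊢
  linarith

theorem conj_le (t : ℝ) {c : ℝ} (h : ∀ w, 0 < w → t * w - A w ≤ c) : conj A t ≤ c := by
  refine csSup_le (nonempty_Ioi.image _) ?_
  rintro _ ⟨w, hw, rfl⟩
  exact h w hw

theorem conj_nonneg (hA : IsYoung A) {t : ℝ} (ht : 0 ≤ t) : 0 ≤ conj A t := by
  by_contra! h
  have h1 := hA.pos one_pos
  -- This `w` is so small that convexity gives `A w ≤ w * A 1 ≤ -conj A t / 2`, contradicting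
  -- Young's inequality at `w`.
  set w := min 1 (-conj A t / (2 * A 1)) with hw
  have hw0 : 0 < w := lt_min one_pos (div_pos (by linarith) (by linarith))
  have h2 := hA.mul_le_add_conj_of_pos t hw0
  have h3 : A w ≤ w * A 1 := by
    have h4 : 0 ≤ 1 - w := by linarith [min_le_left 1 (-conj A t / (2 * A 1))]
    have := hA.convexOn.2 (show (0 : ℝ) ∈ Ici 0 by simp) (show (1 : ℝ) ∈ Ici 0 by simp) h4
      hw0.le (by ring)
    simpa [hA.map_zero] using this
  have h4 : w * (2 * A 1) ≤ -conj A t := by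
    rw [← le_div_iff₀ (by linarith)]
    exact min_le_right _ _
  have : 0 ≤ t * w := by positivity
  linarith

theorem mul_le_add_conj (hA : IsYoung A) {t w : ℝ} (ht : 0 ≤ t) (hw : 0 ≤ w) :
    w * t ≤ A w + conj A t := by
  rcases hw.eq_or_lt with rfl | hw
  · simpa [hA.map_zero] using hA.conj_nonneg ht
  · rw [mul_comm]; exact hA.mul_le_add_conj_of_pos t hw

theorem conj_zero_le (hA : IsYoung A) : conj A 0 ≤ 0 :=
  conj_le 0 fun w hw => by have := hA.pos hw; linarith

/-- Substitute `w = l * w'` in the supremum. The choice `l = k ^ (1 / (pm - 1))` makes `k * l` and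
`l ^ pm` both equal to `k ^ (pm / (pm - 1))`, so this factor comes out of `k * t * w - A w`. -/
theorem conj_mul_le_of_one_le (hA : IsYoung A) (hg : HasGrowth A pm pp) (hpm : 1 < pm)
    {k t : ℝ} (hk : 1 ≤ k) : conj A (k * t) ≤ k ^ (pm / (pm - 1)) * conj A t := by
  have hk0 : 0 < k := by linarith
  have hp : 0 < pm - 1 := by linarith
  refine conj_le _ fun w hw => ?_
  set l := k ^ (1 / (pm - 1)) with hl
  have hl1 : 1 ≤ l := Real.one_le_rpow hk (by positivity)
  have hl0 : 0 < l := by linarith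
  have e1 : l ^ pm = k ^ (pm / (pm - 1)) := by
    rw [hl, ← Real.rpow_mul hk0.le]; congr 1; ring
  have e2 : k * l = k ^ (pm / (pm - 1)) := by
    rw [hl]; nth_rewrite 1 [← Real.rpow_one k]
    rw [← Real.rpow_add hk0]; congr 1; field_simp; ring
  have h1 := hA.rpow_mul_le hg hpm hl1 (div_pos hw hl0).le
  rw [mul_div_cancel₀ _ hl0.ne', e1] at h1
  have h2 := hA.mul_le_add_conj_of_pos t (div_pos hw hl0)
  have h3 := mul_le_mul_of_nonneg_left h2 (Real.rpow_nonneg hk0.le (pm / (pm - 1)))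
  have e3 : k ^ (pm / (pm - 1)) * (t * (w / l)) = k * t * w := by
    rw [← e2]; field_simp
  linarith

theorem conj_mul_le_of_le_one (hA : IsYoung A) (hg : HasGrowth A pm pp) (hpm : 1 < pm)
    (hpp : pm ≤ pp) {k t : ℝ} (hk0 : 0 < k) (hk : k ≤ 1) :
    conj A (k * t) ≤ k ^ (pp / (pp - 1)) * conj A t := by
  have hp : 0 < pp - 1 := by linarith
  refine conj_le _ fun w hw => ?_
  set l := k ^ (1 / (pp - 1)) with hl
  have hl1 : l ≤ 1 := Real.rpow_le_one hk0.le hk (by positivity)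
  have hl0 : 0 < l := by positivity
  have e1 : l ^ pp = k ^ (pp / (pp - 1)) := by
    rw [hl, ← Real.rpow_mul hk0.le]; congr 1; ring
  have e2 : k * l = k ^ (pp / (pp - 1)) := by
    rw [hl]; nth_rewrite 1 [← Real.rpow_one k]
    rw [← Real.rpow_add hk0]; congr 1; field_simp; ring
  have h1 := hA.rpow_mul_le' hg hpm hl0 hl1 (div_pos hw hl0).le
  rw [mul_div_cancel₀ _ hl0.ne', e1] at h1
  have h2 := hA.mul_le_add_conj_of_pos t (div_pos hw hl0)
  have h3 := mul_le_mul_of_nonneg_left h2 (Real.rpow_nonneg hk0.le (pp / (pp - 1)))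
  have e3 : k ^ (pp / (pp - 1)) * (t * (w / l)) = k * t * w := by
    rw [← e2]; field_simp
  linarith

theorem conj_mul_le (hA : IsYoung A) (hg : HasGrowth A pm pp) (hpm : 1 < pm)
    (hpp : pm ≤ pp) {k t : ℝ} (hk0 : 0 ≤ k) (ht : 0 ≤ t) :
    conj A (k * t) ≤ (k ^ (pp / (pp - 1)) + k ^ (pm / (pm - 1))) * conj A t := by
  have h0 := hA.conj_nonneg ht
  rcases hk0.eq_or_lt with rfl | hk0
  · rw [zero_mul]; exact hA.conj_zero_le.trans (by positivity)
  rcases le_total k 1 with hk | hk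
  · refine (hA.conj_mul_le_of_le_one hg hpm hpp hk0 hk).trans ?_
    gcongr
    simp; positivity
  · refine (hA.conj_mul_le_of_one_le hg hpm hk).trans ?_
    gcongr
    simp; positivity

theorem convexOn_conj (hA : IsYoung A) : ConvexOn ℝ univ (conj A) := by
  refine ⟨convex_univ, fun t _ t' _ a b ha hb hab => ?_⟩
  refine conj_le _ fun w hw => ?_
  have h1 := hA.mul_le_add_conj_of_pos t hw
  have h2 := hA.mul_le_add_conj_of_pos t' hw
  simp only [smul_eq_mul]
  have : A w = a * A w + b * A w := by rw [← add_mul, hab, one_mul]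
  nlinarith

/-- Convexity on the whole line makes `conj A` continuous, also at `0`; it is at most `0` at `0` and
at least `y` at `y + A 1` (test with `w = 1`). The intermediate value theorem then gives a preimage,
which is all that `invFunOn` needs. -/
theorem conj_invHalfLine (hA : IsYoung A) {y : ℝ} (hy : 0 < y) :
    0 < invHalfLine (conj A) y ∧ conj A (invHalfLine (conj A) y) = y := by
  have hc : Continuous (conj A) := by
    rw [← continuousOn_univ]; exact hA.convexOn_conj.continuousOn isOpen_univ
  have h0 := hA.conj_zero_le
  have hX : y ≤ conj A (y + A 1) := by
    have := hA.mul_le_add_conj_of_pos (y + A 1) one_pos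
    linarith
  have h1 := hA.pos one_pos
  obtain ⟨T, hT, hTy⟩ := intermediate_value_Icc (by linarith : 0 ≤ y + A 1) hc.continuousOn
    ⟨h0.trans hy.le, hX⟩
  have hex : ∃ a ∈ Ici (0 : ℝ), conj A a = y := ⟨T, hT.1, hTy⟩
  have h2 : invHalfLine (conj A) y ∈ Ici 0 := Function.invFunOn_mem hex
  have h3 : conj A (invHalfLine (conj A) y) = y := Function.invFunOn_eq hex
  refine ⟨lt_of_le_of_ne h2 fun h => ?_, h3⟩
  rw [← h] at h3
  linarith

end IsYoung

/-! ### Pointwise bounds for the Bessel kernel -/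

theorem exp_neg_le_rpow {k y : ℝ} (hk : 0 < k) (hy : 0 < y) :
    Real.exp (-y) ≤ k ^ k * y ^ (-k) := by
  have h1 : y ≤ k * Real.exp (y / k) := by
    have h := Real.add_one_le_exp (y / k)
    have h2 : k * (y / k) ≤ k * Real.exp (y / k) := by gcongr; linarith
    rwa [mul_div_cancel₀ _ hk.ne'] at h2
  have h2 := Real.rpow_le_rpow hy.le h1 hk.le
  rw [Real.mul_rpow hk.le (Real.exp_pos _).le, ← Real.exp_mul, div_mul_cancel₀ _ hk.ne'] at h2
  rw [Real.exp_neg, Real.rpow_neg hy.le, ← div_eq_mul_inv, inv_eq_one_div,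
    div_le_div_iff₀ (Real.exp_pos _) (by positivity)]
  linarith

theorem besselKernel_nonneg (n : ℕ) {s : ℝ} (hs : 0 < s) (x : EuclideanSpace ℝ (Fin n)) :
    0 ≤ besselKernel n s x := by
  have := Real.Gamma_pos_of_pos (half_pos hs)
  refine mul_nonneg (by positivity) (setIntegral_nonneg measurableSet_Ioi fun t ht => ?_)
  have ht : 0 < t := ht
  positivity

theorem besselKernel_eq_of_norm_eq (n : ℕ) (s : ℝ) {x y : EuclideanSpace ℝ (Fin n)}
    (h : ‖x‖ = ‖y‖) : besselKernel n s x = besselKernel n s y := by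
  simp only [besselKernel, h]

theorem measurable_besselKernel (n : ℕ) (s : ℝ) : Measurable (besselKernel n s) := by
  have h : StronglyMeasurable fun x : EuclideanSpace ℝ (Fin n) => ∫ t in Ioi (0 : ℝ),
      Real.exp (-t - ‖x‖ ^ 2 / (4 * t)) * t ^ ((s - n) / 2 - 1) :=
    (meas_aux n s).stronglyMeasurable.integral_prod_right
  exact h.measurable.const_mul _

/-- Trading `exp (-|x|²/(4t))` for a multiple of `(|x|²/(4t)) ^ (-m/2)` leaves a Gamma integral,
convergent exactly when `m > n - s`. Different `m` give the singularity at `0` and the decay at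
infinity. -/
theorem besselKernel_le (n : ℕ) {s m : ℝ} (hs : 0 < s) (hm : 0 < m) (hms : n - s < m) :
    ∃ C : ℝ, 0 ≤ C ∧ ∀ x : EuclideanSpace ℝ (Fin n), x ≠ 0 →
      besselKernel n s x ≤ C * ‖x‖ ^ (-m) := by
  set c : ℝ := ((4 * Real.pi) ^ ((n : ℝ) / 2) * Real.Gamma (s / 2))⁻¹ with hc
  have hG := Real.Gamma_pos_of_pos (half_pos hs)
  have hc0 : 0 ≤ c := by positivity
  have he : 0 < (s - n + m) / 2 := by linarith
  set I : ℝ := ∫ t in Ioi (0 : ℝ), Real.exp (-t) * t ^ ((s - n + m) / 2 - 1) with hI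
  have hI0 : 0 ≤ I := setIntegral_nonneg measurableSet_Ioi fun t ht => by
    have ht : 0 < t := ht
    positivity
  have hint := Real.GammaIntegral_convergent he
  refine ⟨c * ((m / 2) ^ (m / 2) * 4 ^ (m / 2) * I), by positivity, fun x hx => ?_⟩
  have hx0 : 0 < ‖x‖ := norm_pos_iff.2 hx
  have key : ∫ t in Ioi (0 : ℝ), Real.exp (-t - ‖x‖ ^ 2 / (4 * t)) * t ^ ((s - n) / 2 - 1) ≤
      ∫ t in Ioi (0 : ℝ), ((m / 2) ^ (m / 2) * 4 ^ (m / 2) * ‖x‖ ^ (-m)) *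
        (Real.exp (-t) * t ^ ((s - n + m) / 2 - 1)) := by
    refine integral_mono_of_nonneg ?_ (hint.const_mul _) ?_
    · filter_upwards [ae_restrict_mem measurableSet_Ioi] with t ht
      have ht : 0 < t := ht
      simp only [Pi.zero_apply]
      positivity
    · filter_upwards [ae_restrict_mem measurableSet_Ioi] with t ht
      have ht : 0 < t := ht
      have h1 := exp_neg_le_rpow (half_pos hm) (show 0 < ‖x‖ ^ 2 / (4 * t) by positivity)
      have h2 : (‖x‖ ^ 2 / (4 * t)) ^ (-(m / 2)) = 4 ^ (m / 2) * ‖x‖ ^ (-m) * t ^ (m / 2) := by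
        rw [Real.rpow_neg (by positivity), Real.div_rpow (by positivity) (by positivity),
          inv_div, Real.mul_rpow (by norm_num) ht.le, ← Real.rpow_natCast, ← Real.rpow_mul hx0.le,
          Real.rpow_neg hx0.le, show ((2 : ℕ) : ℝ) * (m / 2) = m by push_cast; ring]
        ring
      have h3 : t ^ ((s - n + m) / 2 - 1) = t ^ (m / 2) * t ^ ((s - n) / 2 - 1) := by
        rw [← Real.rpow_add ht]; congr 1; ring
      rw [h2] at h1
      rw [sub_eq_add_neg, Real.exp_add, h3]
      calc Real.exp (-t) * Real.exp (-(‖x‖ ^ 2 / (4 * t))) * t ^ ((s - n) / 2 - 1)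
          ≤ Real.exp (-t) * ((m / 2) ^ (m / 2) * (4 ^ (m / 2) * ‖x‖ ^ (-m) * t ^ (m / 2))) *
            t ^ ((s - n) / 2 - 1) := by gcongr
        _ = _ := by ring
  rw [integral_const_mul, ← hI] at key
  calc besselKernel n s x ≤ c * ((m / 2) ^ (m / 2) * 4 ^ (m / 2) * ‖x‖ ^ (-m) * I) :=
        mul_le_mul_of_nonneg_left key hc0
    _ = _ := by ring

/-! ### Averages of rotation invariant functions over balls -/

section Radial

variable {n : ℕ}

theorem setLIntegral_ball_eq_of_norm_eq {F : EuclideanSpace ℝ (Fin n) → ENNReal}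
    (hinv : ∀ R : EuclideanSpace ℝ (Fin n) ≃ₗᵢ[ℝ] EuclideanSpace ℝ (Fin n),
      (fun y => F (R y)) =ᵐ[volume] F)
    {x y : EuclideanSpace ℝ (Fin n)} (h : ‖x‖ = ‖y‖) (d : ℝ) :
    ∫⁻ z in Metric.ball x d, F z = ∫⁻ z in Metric.ball y d, F z := by
  -- Reflection in the hyperplane bisecting `x` and `y`, which swaps them.
  set R := (Submodule.span ℝ {x - y})ᗮ.reflection with hR
  have hRx : R x = y := Submodule.reflection_sub h
  have h1 := R.measurePreserving.setLIntegral_comp_preimage_emb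
    R.toHomeomorph.measurableEmbedding F (Metric.ball y d)
  have h2 : R ⁻¹' Metric.ball y d = Metric.ball x d := by
    rw [R.preimage_ball, ← hRx, R.symm_apply_apply]
  rw [← h1, h2]
  exact lintegral_congr_ae (ae_restrict_of_ae (hinv R).symm)

/-- By invariance the ball at `x` may be rotated to any center of norm `‖x‖`. Letting the center
follow the direction of `y` in a thin shell and applying Tonelli spreads the mass over the annulus
around the sphere of radius `‖x‖`. -/
theorem setLIntegral_ball_mul_le {F : EuclideanSpace ℝ (Fin n) → ENNReal} (hF : Measurable F)
    (hinv : ∀ R : EuclideanSpace ℝ (Fin n) ≃ₗᵢ[ℝ] EuclideanSpace ℝ (Fin n),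
      (fun y => F (R y)) =ᵐ[volume] F)
    {x : EuclideanSpace ℝ (Fin n)} (hx : x ≠ 0) {d : ℝ} (hd : 0 < d) :
    (∫⁻ z in Metric.ball x d, F z) * volume (Metric.ball 0 (‖x‖ + d) \ Metric.ball 0 ‖x‖ :
        Set (EuclideanSpace ℝ (Fin n))) ≤
      volume (Metric.ball 0 (2 * d) : Set (EuclideanSpace ℝ (Fin n))) *
        ∫⁻ z in {z | |‖z‖ - ‖x‖| < 3 * d}, F z := by
  have hx0 : 0 < ‖x‖ := norm_pos_iff.2 hx
  set S : Set (EuclideanSpace ℝ (Fin n)) := Metric.ball 0 (‖x‖ + d) \ Metric.ball 0 ‖x‖ with hS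
  have hSm : MeasurableSet S := Metric.isOpen_ball.measurableSet.diff
    Metric.isOpen_ball.measurableSet
  have hT : MeasurableSet {z : EuclideanSpace ℝ (Fin n) | |‖z‖ - ‖x‖| < 3 * d} :=
    measurableSet_lt (by fun_prop) measurable_const
  have hmeas : Measurable fun p : EuclideanSpace ℝ (Fin n) × EuclideanSpace ℝ (Fin n) =>
      (Metric.ball p.1 (2 * d)).indicator F p.2 := by
    have hm : MeasurableSet {p : EuclideanSpace ℝ (Fin n) × EuclideanSpace ℝ (Fin n) |
        dist p.2 p.1 < 2 * d} := measurableSet_lt (by fun_prop) measurable_const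
    exact (hF.comp measurable_snd).indicator hm
  calc (∫⁻ z in Metric.ball x d, F z) * volume S
      = ∫⁻ _ in S, (∫⁻ z in Metric.ball x d, F z) := (setLIntegral_const _ _).symm
    _ ≤ ∫⁻ y in S, ∫⁻ z, (Metric.ball y (2 * d)).indicator F z := by
        refine setLIntegral_mono' hSm fun y hy => ?_
        rw [hS, Set.mem_sdiff, mem_ball_zero_iff, mem_ball_zero_iff, not_lt] at hy
        have hy0 : 0 < ‖y‖ := hx0.trans_le hy.2
        rw [lintegral_indicator Metric.isOpen_ball.measurableSet]
        -- The radial projection of `y` to the sphere of radius `‖x‖`; it is within `d` of `y`, so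
        -- its `d`-ball lies in the `2 * d`-ball at `y`.
        have hn : ‖x‖ = ‖(‖x‖ / ‖y‖) • y‖ := by
          rw [norm_smul, Real.norm_of_nonneg (by positivity), div_mul_cancel₀ _ hy0.ne']
        rw [setLIntegral_ball_eq_of_norm_eq hinv hn d]
        refine lintegral_mono_set (Metric.ball_subset_ball' ?_)
        have : dist ((‖x‖ / ‖y‖) • y) y = ‖y‖ - ‖x‖ := by
          rw [dist_eq_norm, show (‖x‖ / ‖y‖) • y - y = (‖x‖ / ‖y‖ - 1) • y by
            rw [sub_smul, one_smul], norm_smul, Real.norm_of_nonpos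
            (by rw [sub_nonpos, div_le_one hy0]; exact hy.2)]
          field_simp
          ring
        rw [this]
        linarith [hy.1]
    _ = ∫⁻ z, ∫⁻ y in S, (Metric.ball y (2 * d)).indicator F z :=
        lintegral_lintegral_swap hmeas.aemeasurable
    _ ≤ ∫⁻ z, {z | |‖z‖ - ‖x‖| < 3 * d}.indicator
          (fun z => volume (Metric.ball 0 (2 * d) : Set (EuclideanSpace ℝ (Fin n))) * F z) z := by
        refine lintegral_mono fun z => ?_
        by_cases hz : z ∈ {z : EuclideanSpace ℝ (Fin n) | |‖z‖ - ‖x‖| < 3 * d}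
        · rw [indicator_of_mem hz]
          calc ∫⁻ y in S, (Metric.ball y (2 * d)).indicator F z
              ≤ ∫⁻ y, (Metric.ball y (2 * d)).indicator F z := setLIntegral_le_lintegral _ _
            _ = ∫⁻ y, (Metric.ball z (2 * d)).indicator (fun _ => F z) y := by
                refine lintegral_congr fun y => ?_
                simp only [indicator, Metric.mem_ball, dist_comm]
            _ = volume (Metric.ball 0 (2 * d) : Set (EuclideanSpace ℝ (Fin n))) * F z := by
                rw [lintegral_indicator_const Metric.isOpen_ball.measurableSet, mul_comm,
                  Measure.addHaar_ball_center]
        · rw [indicator_of_notMem hz]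
          refine (setLIntegral_eq_zero hSm fun y hy => ?_).le
          refine indicator_of_notMem (fun h => hz ?_) _
          rw [hS, Set.mem_sdiff, mem_ball_zero_iff, mem_ball_zero_iff, not_lt] at hy
          rw [Metric.mem_ball, dist_eq_norm] at h
          have h1 := abs_norm_sub_norm_le z y
          simp only [mem_ofPred_eq]
          rw [abs_lt]
          have h2 := abs_lt.1 (h1.trans_lt h)
          constructor <;> linarith [hy.1, hy.2, h2.1, h2.2]
    _ = _ := by
        rw [lintegral_indicator hT, lintegral_const_mul _ hF]

theorem setLIntegral_ball_le (hn : 1 ≤ n) {F : EuclideanSpace ℝ (Fin n) → ENNReal}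
    (hF : Measurable F)
    (hinv : ∀ R : EuclideanSpace ℝ (Fin n) ≃ₗᵢ[ℝ] EuclideanSpace ℝ (Fin n),
      (fun y => F (R y)) =ᵐ[volume] F)
    {x : EuclideanSpace ℝ (Fin n)} (hx : x ≠ 0) {d : ℝ} (hd : 0 < d) :
    ∫⁻ z in Metric.ball x d, F z ≤ ENNReal.ofReal (2 ^ n * (d / (‖x‖ + d)) ^ (n - 1)) *
      ∫⁻ z in {z | |‖z‖ - ‖x‖| < 3 * d}, F z := by
  obtain ⟨k, rfl⟩ : ∃ k, n = k + 1 := ⟨n - 1, by omega⟩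
  have hx0 : 0 < ‖x‖ := norm_pos_iff.2 hx
  have h := setLIntegral_ball_mul_le hF hinv hx hd
  set w := volume (Metric.ball 0 1 : Set (EuclideanSpace ℝ (Fin (k + 1)))) with hw
  have hw0 : w ≠ 0 := (Metric.measure_ball_pos _ _ one_pos).ne'
  have hwt : w ≠ ⊤ := measure_ball_lt_top.ne
  have e1 : volume (Metric.ball 0 (2 * d) : Set (EuclideanSpace ℝ (Fin (k + 1)))) =
      ENNReal.ofReal ((2 * d) ^ (k + 1)) * w := by
    rw [Measure.addHaar_ball _ _ (by positivity), finrank_euclideanSpace_fin]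
  have e2 : ENNReal.ofReal (d * (‖x‖ + d) ^ k) * w ≤
      volume (Metric.ball 0 (‖x‖ + d) \ Metric.ball 0 ‖x‖ :
        Set (EuclideanSpace ℝ (Fin (k + 1)))) := by
    rw [measure_sdiff (Metric.ball_subset_ball (by linarith))
      Metric.isOpen_ball.measurableSet.nullMeasurableSet measure_ball_lt_top.ne,
      Measure.addHaar_ball volume _ (show 0 ≤ ‖x‖ + d by positivity),
      Measure.addHaar_ball volume _ hx0.le,
      finrank_euclideanSpace_fin, ← ENNReal.sub_mul (fun _ _ => hwt),
      ← ENNReal.ofReal_sub _ (by positivity)]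
    gcongr
    have : ‖x‖ * ‖x‖ ^ k ≤ ‖x‖ * (‖x‖ + d) ^ k := by gcongr; linarith
    rw [pow_succ, pow_succ]
    linarith
  have h2 := (mul_le_mul_right e2 (∫⁻ z in Metric.ball x d, F z)).trans h
  rw [e1, ← mul_assoc, mul_right_comm _ w, ENNReal.mul_le_mul_iff_left hw0 hwt] at h2
  have hpos : 0 < d * (‖x‖ + d) ^ k := by positivity
  rw [← ENNReal.le_div_iff_mul_le (Or.inl (by simpa using hpos)) (Or.inl ENNReal.ofReal_ne_top)]
    at h2
  refine h2.trans (le_of_eq ?_)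
  rw [mul_comm, mul_div_assoc, mul_comm, ← ENNReal.ofReal_div_of_pos hpos, Nat.add_sub_cancel]
  congr 2
  rw [mul_pow, div_pow, pow_succ d k]
  field_simp

end Radial

/-! ### The radial majorant of the Bessel kernel -/

/-- A function of order `t ^ (σ - 1)` at `0` and `t ^ (-2)` at `∞`. -/
def decay (σ t : ℝ) : ℝ := min (t ^ (σ - 1)) (t ^ (-2 : ℝ))

/-- Up to a constant, a majorant for the mean of `G_s(x - y)` over all `x` with `‖x‖ = r`. -/
def radialMajorant (n : ℕ) (σ r : ℝ) (y : EuclideanSpace ℝ (Fin n)) : ℝ :=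
  ((r + |‖y‖ - r|) ^ (n - 1))⁻¹ * decay σ |‖y‖ - r|

theorem decay_nonneg (σ : ℝ) {t : ℝ} (ht : 0 ≤ t) : 0 ≤ decay σ t :=
  le_min (by positivity) (by positivity)

theorem measurable_decay (σ : ℝ) : Measurable (decay σ) := by
  unfold decay; fun_prop

theorem radialMajorant_nonneg (n : ℕ) (σ : ℝ) {r : ℝ} (hr : 0 ≤ r)
    (y : EuclideanSpace ℝ (Fin n)) : 0 ≤ radialMajorant n σ r y :=
  mul_nonneg (by positivity) (decay_nonneg σ (abs_nonneg _))

theorem measurable_radialMajorant (n : ℕ) (σ r : ℝ) : Measurable (radialMajorant n σ r) := by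
  have := measurable_decay σ
  unfold radialMajorant; fun_prop

/-- The range `a < t ≤ 2 * a` already suffices: the integrand is there at least its value at `2 *
a`, which costs at most `2 ^ (n + 2)`. This writes the kernel bound at distance `a` as a
superposition of indicators of `a < t`. -/
theorem ofReal_min_rpow_le_lintegral (n : ℕ) {σ a : ℝ} (hσ : 0 < σ) (hσ1 : σ < 1)
    (ha : 0 < a) :
    ENNReal.ofReal (min (a ^ (σ - n)) (a ^ (-(n + 1 : ℝ)))) ≤
      ENNReal.ofReal (2 ^ (n + 2)) *
        ∫⁻ t in Ioi a, ENNReal.ofReal (min (t ^ (σ - n - 1)) (t ^ (-(n + 2 : ℝ)))) := by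
  have hcase : σ - n - 1 ≤ 0 := by linarith [n.cast_nonneg (α := ℝ)]
  have h1 : ∫⁻ _ in Ioc a (2 * a), ENNReal.ofReal
        (min ((2 * a) ^ (σ - n - 1)) ((2 * a) ^ (-(n + 2 : ℝ)))) ≤
      ∫⁻ t in Ioi a, ENNReal.ofReal (min (t ^ (σ - n - 1)) (t ^ (-(n + 2 : ℝ)))) := by
    refine (setLIntegral_mono' measurableSet_Ioc fun t ht => ?_).trans
      (lintegral_mono_set Ioc_subset_Ioi_self)
    have ht0 : 0 < t := ha.trans ht.1
    have hn : -(n + 2 : ℝ) ≤ 0 := by linarith [n.cast_nonneg (α := ℝ)]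
    refine ENNReal.ofReal_le_ofReal (min_le_min ?_ ?_)
    · exact Real.rpow_le_rpow_of_nonpos ht0 ht.2 hcase
    · exact Real.rpow_le_rpow_of_nonpos ht0 ht.2 hn
  refine le_trans ?_ (mul_le_mul_right h1 _)
  rw [setLIntegral_const, Real.volume_Ioc, ← ENNReal.ofReal_mul (by positivity),
    ← ENNReal.ofReal_mul (by positivity)]
  refine ENNReal.ofReal_le_ofReal ?_
  rw [show 2 * a - a = a by ring, min_mul_of_nonneg _ _ ha.le, mul_min_of_nonneg _ _ (by positivity)]
  have e : (2 : ℝ) ^ (n + 2) = 2 ^ (n + 2 : ℝ) := by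
    rw [← Real.rpow_natCast]; push_cast; rfl
  refine min_le_min ?_ ?_
  · rw [Real.mul_rpow two_pos.le ha.le, mul_assoc, ← Real.rpow_add_one ha.ne', ← mul_assoc, e,
      ← Real.rpow_add two_pos, show σ - n - 1 + 1 = σ - n by ring]
    refine le_mul_of_one_le_left (by positivity) (Real.one_le_rpow one_le_two (by linarith))
  · rw [Real.mul_rpow two_pos.le ha.le, mul_assoc, ← Real.rpow_add_one ha.ne', ← mul_assoc, e,
      ← Real.rpow_add two_pos, show -(n + 2 : ℝ) + 1 = -(n + 1) by ring]
    refine le_mul_of_one_le_left (by positivity) (Real.one_le_rpow one_le_two (by linarith))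

theorem setLIntegral_decay_le {n : ℕ} (hn : 1 ≤ n) {σ r h : ℝ} (hσ : σ < 1) (hr : 0 < r)
    (hh : 0 < h) :
    ∫⁻ t in Ioi (h / 3), ENNReal.ofReal (min (t ^ (σ - n - 1)) (t ^ (-(n + 2 : ℝ)))) *
        ENNReal.ofReal ((t / (r + t)) ^ (n - 1)) ≤
      ENNReal.ofReal (3 ^ (n - 1) * (3 ^ (1 - σ) / (1 - σ) + 9 / 2)) *
        ENNReal.ofReal (((r + h) ^ (n - 1))⁻¹ * decay σ h) := by
  obtain ⟨k, rfl⟩ : ∃ k, n = k + 1 := ⟨n - 1, by omega⟩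
  have hσ' : 0 < 1 - σ := by linarith
  have hh3 : 0 < h / 3 := by positivity
  -- Either term of the minimum alone bounds the integral, with exponent `e = σ - 2` or `e = -3`
  -- after absorbing `t ^ k`. The factor `3 ^ k` comes from `r + h ≤ 3 * (r + t)` when `t > h / 3`.
  have hle : ∀ e : ℝ, e < -1 → (∀ t : ℝ, 0 < t → min (t ^ (σ - (k + 1 : ℕ) - 1))
      (t ^ (-((k + 1 : ℕ) + 2 : ℝ))) * t ^ k ≤ t ^ e) →
      ∫⁻ t in Ioi (h / 3), ENNReal.ofReal (min (t ^ (σ - (k + 1 : ℕ) - 1))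
        (t ^ (-((k + 1 : ℕ) + 2 : ℝ)))) * ENNReal.ofReal ((t / (r + t)) ^ k) ≤
      ENNReal.ofReal (3 ^ k * ((r + h) ^ k)⁻¹ * (-(h / 3) ^ (e + 1) / (e + 1))) := by
    intro e he hb
    rw [← integral_Ioi_rpow_of_lt he hh3, ← integral_const_mul, ofReal_integral_eq_lintegral_ofReal
      ((integrableOn_Ioi_rpow_of_lt he hh3).const_mul _)]
    · refine setLIntegral_mono' measurableSet_Ioi fun t ht => ?_
      have ht1 : h / 3 < t := ht
      have ht0 : 0 < t := hh3.trans ht1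
      rw [← ENNReal.ofReal_mul (le_min (by positivity) (by positivity))]
      refine ENNReal.ofReal_le_ofReal ?_
      have h1 : ((r + t) ^ k)⁻¹ ≤ 3 ^ k * ((r + h) ^ k)⁻¹ := by
        rw [← div_eq_mul_inv, ← div_pow, ← inv_pow]
        refine pow_le_pow_left₀ (by positivity) ?_ k
        rw [inv_eq_one_div, div_le_div_iff₀ (by positivity) (by positivity)]
        linarith
      calc _ = ((r + t) ^ k)⁻¹ * (min (t ^ (σ - (k + 1 : ℕ) - 1))
            (t ^ (-((k + 1 : ℕ) + 2 : ℝ))) * t ^ k) := by rw [div_pow]; ring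
        _ ≤ _ := mul_le_mul h1 (hb t ht0)
          (mul_nonneg (le_min (by positivity) (by positivity)) (by positivity)) (by positivity)
    · filter_upwards [ae_restrict_mem measurableSet_Ioi] with t ht
      have ht0 : 0 < t := hh3.trans ht
      simp only [Pi.zero_apply]
      positivity
  have hA := hle (σ - 2) (by linarith) fun t ht => by
    calc _ ≤ t ^ (σ - (k + 1 : ℕ) - 1) * t ^ k := by gcongr; exact min_le_left _ _
      _ = _ := by rw [← Real.rpow_natCast t k, ← Real.rpow_add ht]; congr 1; push_cast; ring
  have hB := hle (-3) (by norm_num) fun t ht => by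
    calc _ ≤ t ^ (-((k + 1 : ℕ) + 2 : ℝ)) * t ^ k := by gcongr; exact min_le_right _ _
      _ = _ := by rw [← Real.rpow_natCast t k, ← Real.rpow_add ht]; congr 1; push_cast; ring
  simp only [Nat.add_sub_cancel]
  rw [← ENNReal.ofReal_mul (by positivity)]
  have e1 : -(h / 3) ^ (σ - 2 + 1) / (σ - 2 + 1) = 3 ^ (1 - σ) / (1 - σ) * h ^ (σ - 1) := by
    rw [show σ - 2 + 1 = -(1 - σ) by ring, neg_div_neg_eq, Real.rpow_neg hh3.le,
      Real.div_rpow hh.le (by norm_num), show σ - 1 = -(1 - σ) by ring, Real.rpow_neg hh.le]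
    field_simp
  have e2 : -(h / 3) ^ (-3 + 1 : ℝ) / (-3 + 1) = 9 / 2 * h ^ (-2 : ℝ) := by
    rw [show (-3 + 1 : ℝ) = -(2 : ℕ) by norm_num, Real.rpow_neg hh3.le, Real.rpow_natCast,
      show (-2 : ℝ) = -(2 : ℕ) by norm_num, Real.rpow_neg hh.le, Real.rpow_natCast]
    push_cast
    field_simp
    norm_num
  rw [e1] at hA
  rw [e2] at hB
  rcases min_choice (h ^ (σ - 1)) (h ^ (-2 : ℝ)) with hm | hm
  · refine hA.trans (ENNReal.ofReal_le_ofReal ?_)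
    rw [decay, hm]
    calc _ ≤ 3 ^ k * ((r + h) ^ k)⁻¹ * ((3 ^ (1 - σ) / (1 - σ) + 9 / 2) * h ^ (σ - 1)) := by
          gcongr; linarith
      _ = _ := by ring
  · refine hB.trans (ENNReal.ofReal_le_ofReal ?_)
    rw [decay, hm]
    have : 0 < (3 : ℝ) ^ (1 - σ) / (1 - σ) := by positivity
    calc _ ≤ 3 ^ k * ((r + h) ^ k)⁻¹ * ((3 ^ (1 - σ) / (1 - σ) + 9 / 2) * h ^ (-2 : ℝ)) := by
          gcongr; linarith
      _ = _ := by ring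

theorem besselKernel_le_min {n : ℕ} (hn : 1 ≤ n) {s σ : ℝ} (hs : 0 < s) (hσ1 : σ < 1)
    (hσs : σ < s) :
    ∃ C : ℝ, 0 ≤ C ∧ ∀ x : EuclideanSpace ℝ (Fin n), x ≠ 0 →
      besselKernel n s x ≤ C * min (‖x‖ ^ (σ - n)) (‖x‖ ^ (-(n + 1 : ℝ))) := by
  have hn' : (1 : ℝ) ≤ n := by exact_mod_cast hn
  obtain ⟨C₁, h₁, hC₁⟩ := besselKernel_le n (m := n - σ) hs (by linarith) (by linarith)
  obtain ⟨C₂, h₂, hC₂⟩ := besselKernel_le n (m := n + 1) hs (by linarith) (by linarith)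
  refine ⟨max C₁ C₂, le_max_of_le_left h₁, fun x hx => ?_⟩
  rw [mul_min_of_nonneg _ _ (le_max_of_le_left h₁)]
  refine le_min ?_ ?_
  · rw [← neg_sub]
    exact (hC₁ x hx).trans (mul_le_mul_of_nonneg_right (le_max_left _ _) (by positivity))
  · exact (hC₂ x hx).trans (mul_le_mul_of_nonneg_right (le_max_right _ _) (by positivity))

theorem ae_norm_ne {n : ℕ} (hn : 1 ≤ n) (r : ℝ) :
    ∀ᵐ y : EuclideanSpace ℝ (Fin n), ‖y‖ ≠ r := by
  obtain ⟨k, rfl⟩ : ∃ k, n = k + 1 := ⟨n - 1, by omega⟩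
  have h := Measure.addHaar_sphere (volume : Measure (EuclideanSpace ℝ (Fin (k + 1)))) 0 r
  filter_upwards [measure_eq_zero_iff_ae_notMem.1 h] with y hy
  simpa using hy

theorem ae_ne {n : ℕ} (hn : 1 ≤ n) (x : EuclideanSpace ℝ (Fin n)) : ∀ᵐ y, y ≠ x := by
  obtain ⟨k, rfl⟩ : ∃ k, n = k + 1 := ⟨n - 1, by omega⟩
  exact Measure.ae_ne volume x

/-- The potential of a rotation invariant function is controlled by an integral against the
radial majorant. -/
theorem lintegral_besselKernel_mul_le {n : ℕ} (hn : 1 ≤ n) {s σ : ℝ} (hs : 0 < s) (hσ : 0 < σ)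
    (hσ1 : σ < 1) (hσs : σ < s) :
    ∃ C : ℝ, 0 ≤ C ∧ ∀ F : EuclideanSpace ℝ (Fin n) → ENNReal, Measurable F →
      (∀ R : EuclideanSpace ℝ (Fin n) ≃ₗᵢ[ℝ] EuclideanSpace ℝ (Fin n),
        (fun y => F (R y)) =ᵐ[volume] F) →
      ∀ x : EuclideanSpace ℝ (Fin n), x ≠ 0 →
        ∫⁻ y, ENNReal.ofReal (besselKernel n s (x - y)) * F y ≤
          ENNReal.ofReal C * ∫⁻ y, ENNReal.ofReal (radialMajorant n σ ‖x‖ y) * F y := by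
  obtain ⟨C₀, hC₀, hC⟩ := besselKernel_le_min hn hs hσ1 hσs
  have hσ' : 0 < 1 - σ := by linarith
  set C₁ : ℝ := 3 ^ (n - 1) * (3 ^ (1 - σ) / (1 - σ) + 9 / 2) with hC₁
  refine ⟨C₀ * 2 ^ (n + 2) * 2 ^ n * C₁, by positivity, fun F hF hinv x hx => ?_⟩
  have hr : 0 < ‖x‖ := norm_pos_iff.2 hx
  set φ : ℝ → ENNReal :=
    fun t => ENNReal.ofReal (min (t ^ (σ - n - 1)) (t ^ (-(n + 2 : ℝ)))) with hφ
  have hφm : Measurable φ := by rw [hφ]; fun_prop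
  set ψ : ℝ → ENNReal := fun t => ENNReal.ofReal ((t / (‖x‖ + t)) ^ (n - 1)) with hψ
  have hψm : Measurable ψ := by rw [hψ]; fun_prop
  -- `Φ₁` cuts the potential into balls `B(x, t)` and `Φ₂` into the shells that replace them;
  -- integrating either in `t` for fixed `y` returns a kernel times `F y`.
  set Φ₁ : ℝ → EuclideanSpace ℝ (Fin n) → ENNReal := fun t y =>
    {p : ℝ × EuclideanSpace ℝ (Fin n) | ‖x - p.2‖ < p.1}.indicator
      (fun p => φ p.1 * F p.2) (t, y) with hΦ₁
  set Φ₂ : ℝ → EuclideanSpace ℝ (Fin n) → ENNReal := fun t y =>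
    {p : ℝ × EuclideanSpace ℝ (Fin n) | |‖p.2‖ - ‖x‖| < 3 * p.1}.indicator
      (fun p => φ p.1 * ψ p.1 * F p.2) (t, y) with hΦ₂
  have hΦ₁m : Measurable (Function.uncurry Φ₁) := by
    refine Measurable.indicator (by fun_prop) (measurableSet_lt (by fun_prop) (by fun_prop))
  have hΦ₂m : Measurable (Function.uncurry Φ₂) := by
    refine Measurable.indicator (by fun_prop) (measurableSet_lt (by fun_prop) (by fun_prop))
  have step1 : ∫⁻ y, ENNReal.ofReal (besselKernel n s (x - y)) * F y ≤
      ∫⁻ y, ENNReal.ofReal (C₀ * 2 ^ (n + 2)) * ∫⁻ t in Ioi 0, Φ₁ t y := by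
    refine lintegral_mono_ae ?_
    filter_upwards [ae_ne hn x] with y hy
    have hxy : x - y ≠ 0 := sub_ne_zero.2 hy.symm
    have hn0 : 0 < ‖x - y‖ := norm_pos_iff.2 hxy
    have e : ∫⁻ t in Ioi 0, Φ₁ t y = (∫⁻ t in Ioi ‖x - y‖, φ t) * F y := by
      rw [← lintegral_mul_const _ hφm, ← lintegral_indicator measurableSet_Ioi,
        ← lintegral_indicator measurableSet_Ioi]
      refine lintegral_congr fun t => ?_
      by_cases ht : ‖x - y‖ < t
      · simp [hΦ₁, indicator, ht, hn0.trans ht]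
      · simp [hΦ₁, indicator, ht]
    rw [e, ← mul_assoc]
    gcongr
    rw [ENNReal.ofReal_mul hC₀, mul_assoc]
    refine (ENNReal.ofReal_le_ofReal (hC _ hxy)).trans ?_
    rw [ENNReal.ofReal_mul hC₀]
    gcongr
    exact ofReal_min_rpow_le_lintegral n hσ hσ1 hn0
  have step2 : ∫⁻ y, ∫⁻ t in Ioi 0, Φ₁ t y ≤
      ENNReal.ofReal (2 ^ n) * ∫⁻ y, ∫⁻ t in Ioi 0, Φ₂ t y := by
    rw [lintegral_lintegral_swap (μ := volume) (ν := volume.restrict (Ioi 0))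
        (f := fun y t => Φ₁ t y) (hΦ₁m.comp measurable_swap).aemeasurable,
      lintegral_lintegral_swap (μ := volume) (ν := volume.restrict (Ioi 0))
        (f := fun y t => Φ₂ t y) (hΦ₂m.comp measurable_swap).aemeasurable,
      ← lintegral_const_mul _ (by exact hΦ₂m.lintegral_prod_right')]
    refine setLIntegral_mono' measurableSet_Ioi fun t ht => ?_
    have ht0 : 0 < t := ht
    have e1 : ∫⁻ y, Φ₁ t y = φ t * ∫⁻ y in Metric.ball x t, F y := by
      rw [← lintegral_const_mul _ hF, ← lintegral_indicator Metric.isOpen_ball.measurableSet]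
      refine lintegral_congr fun y => ?_
      simp only [hΦ₁, indicator, Metric.mem_ball, dist_comm y x, dist_eq_norm, mem_ofPred_eq]
    have e2 : ∫⁻ y, Φ₂ t y = φ t * ψ t * ∫⁻ y in {y | |‖y‖ - ‖x‖| < 3 * t}, F y := by
      rw [← lintegral_const_mul _ hF, ← lintegral_indicator
        (measurableSet_lt (by fun_prop) measurable_const)]
      refine lintegral_congr fun y => ?_
      simp only [hΦ₂, indicator, mem_ofPred_eq]
    rw [e1, e2]
    refine (mul_le_mul_right (setLIntegral_ball_le hn hF hinv hx ht0) _).trans (le_of_eq ?_)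
    rw [ENNReal.ofReal_mul (by positivity)]
    ring
  have step3 : ∫⁻ y, ∫⁻ t in Ioi 0, Φ₂ t y ≤
      ∫⁻ y, ENNReal.ofReal C₁ * (ENNReal.ofReal (radialMajorant n σ ‖x‖ y) * F y) := by
    refine lintegral_mono_ae ?_
    filter_upwards [ae_norm_ne hn ‖x‖] with y hy
    have hh : 0 < |‖y‖ - ‖x‖| := abs_pos.2 (sub_ne_zero.2 hy)
    have e : ∫⁻ t in Ioi 0, Φ₂ t y = (∫⁻ t in Ioi (|‖y‖ - ‖x‖| / 3), φ t * ψ t) * F y := by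
      rw [← lintegral_mul_const _ (by exact hφm.mul hψm), ← lintegral_indicator measurableSet_Ioi,
        ← lintegral_indicator measurableSet_Ioi]
      refine lintegral_congr fun t => ?_
      by_cases ht : |‖y‖ - ‖x‖| < 3 * t
      · have h1 : |‖y‖ - ‖x‖| / 3 < t := by linarith
        have h2 : 0 < t := by linarith
        simp [hΦ₂, indicator, ht, h1, h2]
      · have h1 : ¬ |‖y‖ - ‖x‖| / 3 < t := by intro h; exact ht (by linarith)
        simp [hΦ₂, indicator, ht, h1]
    rw [e, ← mul_assoc]
    gcongr
    exact setLIntegral_decay_le hn hσ1 hr hh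
  calc _ ≤ _ := step1
    _ = ENNReal.ofReal (C₀ * 2 ^ (n + 2)) * ∫⁻ y, ∫⁻ t in Ioi 0, Φ₁ t y :=
        lintegral_const_mul _ (by exact hΦ₁m.lintegral_prod_left')
    _ ≤ ENNReal.ofReal (C₀ * 2 ^ (n + 2)) * (ENNReal.ofReal (2 ^ n) *
          ∫⁻ y, ENNReal.ofReal C₁ * (ENNReal.ofReal (radialMajorant n σ ‖x‖ y) * F y)) := by
        gcongr
        exact step2.trans (by gcongr)
    _ = _ := by
        rw [lintegral_const_mul _
            (by exact (measurable_radialMajorant n σ ‖x‖).ennreal_ofReal.mul hF),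
          ← mul_assoc, ← mul_assoc, ← ENNReal.ofReal_mul (by positivity),
          ← ENNReal.ofReal_mul (by positivity)]

/-! ### Power integrals of the radial majorant in polar coordinates -/

theorem integrable_decay_rpow {σ q : ℝ} (hq : 1 ≤ q) (hσq : (1 - σ) * q < 1) :
    Integrable fun t : ℝ => decay σ |t| ^ q := by
  have hm : Measurable fun t => decay σ t ^ q := (measurable_decay σ).pow_const q
  have h : IntegrableOn (fun t => decay σ t ^ q) (Ioi 0) := by
    rw [← Ioc_union_Ioi_eq_Ioi zero_le_one]
    refine IntegrableOn.union ?_ ?_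
    · have h1 : IntegrableOn (fun t : ℝ => t ^ ((σ - 1) * q)) (Ioc 0 1) := by
        rw [integrableOn_Ioc_iff_integrableOn_Ioo,
          intervalIntegral.integrableOn_Ioo_rpow_iff one_pos]
        linarith
      refine h1.mono' hm.aestronglyMeasurable ?_
      filter_upwards [ae_restrict_mem measurableSet_Ioc] with t ht
      have ht0 : 0 < t := ht.1
      have h0 := decay_nonneg σ ht0.le
      rw [Real.norm_of_nonneg (by positivity), Real.rpow_mul ht0.le]
      exact Real.rpow_le_rpow h0 (min_le_left _ _) (by linarith)
    · have h1 := integrableOn_Ioi_rpow_of_lt (show -2 * q < -1 by linarith) one_pos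
      refine h1.mono' hm.aestronglyMeasurable ?_
      filter_upwards [ae_restrict_mem measurableSet_Ioi] with t ht
      have ht0 : 0 < t := one_pos.trans ht
      have h0 := decay_nonneg σ ht0.le
      rw [Real.norm_of_nonneg (by positivity), Real.rpow_mul ht0.le]
      exact Real.rpow_le_rpow h0 (min_le_right _ _) (by linarith)
  have := integrable_fun_norm_addHaar (volume : Measure ℝ) (f := fun t => decay σ t ^ q)
  simp only [Real.norm_eq_abs] at this
  rw [this]
  simpa using h

/-- The weight `‖y‖ ^ (1 - n)` cancels the polar Jacobian. Enlarging the half-line to the line and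
translating by `r` removes the dependence on `r`. -/
theorem lintegral_decay_rpow_le {n : ℕ} (hn : 1 ≤ n) {σ q : ℝ} (hq : 1 ≤ q)
    (hσq : (1 - σ) * q < 1) :
    ∃ D : ℝ, 0 ≤ D ∧ ∀ r : ℝ, 0 < r → ∫⁻ y : EuclideanSpace ℝ (Fin n),
      ENNReal.ofReal ((‖y‖ ^ (n - 1))⁻¹ * decay σ |‖y‖ - r| ^ q) ≤ ENNReal.ofReal D := by
  obtain ⟨k, rfl⟩ : ∃ k, n = k + 1 := ⟨n - 1, by omega⟩
  have hint := integrable_decay_rpow hq hσq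
  have hnn : ∀ t : ℝ, 0 ≤ decay σ |t| ^ q := fun t =>
    Real.rpow_nonneg (decay_nonneg σ (abs_nonneg t)) q
  have hI : 0 ≤ ∫ t : ℝ, decay σ |t| ^ q := integral_nonneg hnn
  set w := volume.real (Metric.ball 0 1 : Set (EuclideanSpace ℝ (Fin (k + 1))))
  refine ⟨(k + 1 : ℕ) * (w * ∫ t : ℝ, decay σ |t| ^ q), by positivity, fun r hr => ?_⟩
  have hir := hint.comp_sub_right r
  set f : ℝ → ℝ := fun t => (t ^ k)⁻¹ * decay σ |t - r| ^ q with hf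
  have hcongr : EqOn (fun t => t ^ k • f t) (fun t => decay σ |t - r| ^ q) (Ioi 0) := by
    intro t ht
    have ht0 : 0 < t := ht
    simp only [hf, smul_eq_mul]
    field_simp
  have hfi : Integrable (fun y : EuclideanSpace ℝ (Fin (k + 1)) => f ‖y‖) := by
    rw [integrable_fun_norm_addHaar, finrank_euclideanSpace_fin, Nat.add_sub_cancel,
      integrableOn_congr_fun hcongr measurableSet_Ioi]
    exact hir.integrableOn
  simp only [Nat.add_sub_cancel]
  rw [← ofReal_integral_eq_lintegral_ofReal hfi
    (ae_of_all _ fun y => mul_nonneg (by positivity) (hnn _))]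
  refine ENNReal.ofReal_le_ofReal ?_
  rw [integral_fun_norm_addHaar, finrank_euclideanSpace_fin, Nat.add_sub_cancel,
    setIntegral_congr_fun measurableSet_Ioi hcongr, nsmul_eq_mul, smul_eq_mul]
  gcongr
  rw [← integral_sub_right_eq_self (fun t => decay σ |t| ^ q) r]
  exact setIntegral_le_integral hir (ae_of_all _ fun t => hnn _)

/-! ### Injectivity of the Bessel potential -/

section Injectivity

open FourierTransform SchwartzMap

variable {n : ℕ}

/-- The weight `(1 + |y|)^{-(n+1)}`. -/
def polyWeight (n : ℕ) (y : EuclideanSpace ℝ (Fin n)) : ℝ := ((1 + ‖y‖) ^ (n + 1))⁻¹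

theorem polyWeight_pos (y : EuclideanSpace ℝ (Fin n)) : 0 < polyWeight n y := by
  unfold polyWeight; positivity

theorem continuous_polyWeight : Continuous (polyWeight n) := by
  unfold polyWeight
  exact Continuous.inv₀ (by fun_prop) fun y => by positivity

theorem integrable_polyWeight : Integrable (polyWeight n) := by
  have h := integrable_one_add_norm (μ := (volume : Measure (EuclideanSpace ℝ (Fin n))))
    (r := (n + 1 : ℕ)) (by rw [finrank_euclideanSpace_fin]; push_cast; linarith)
  refine h.congr (ae_of_all _ fun y => ?_)
  simp only [polyWeight]
  rw [Real.rpow_neg (by positivity), Real.rpow_natCast]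

/-- This moves the weight from `x` to `y` at the price of a polynomial factor in `x - y`, which the
rapidly decaying Bessel kernel absorbs. -/
theorem polyWeight_le (x y : EuclideanSpace ℝ (Fin n)) :
    polyWeight n x ≤ (1 + ‖x - y‖) ^ (n + 1) * polyWeight n y := by
  unfold polyWeight
  rw [← div_eq_mul_inv, inv_eq_one_div, div_le_div_iff₀ (by positivity) (by positivity), one_mul,
    ← mul_pow]
  gcongr
  have h1 : ‖y‖ ≤ ‖x‖ + ‖x - y‖ := by
    have := norm_sub_norm_le y x
    rw [norm_sub_rev] at this
    linarith
  nlinarith [norm_nonneg x, norm_nonneg (x - y)]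

theorem integrable_besselKernel_mul_pow {s : ℝ} (hs : 0 < s) :
    Integrable fun z : EuclideanSpace ℝ (Fin n) => besselKernel n s z * (1 + ‖z‖) ^ (n + 1) := by
  -- The exponent `2 * n + 2` pays for the factor of degree `n + 1` and still leaves an integrable
  -- `polyWeight` at infinity.
  obtain ⟨C, hC0, hC⟩ := besselKernel_le n (m := (2 * n + 2 : ℕ)) hs (by positivity)
    (by push_cast; linarith [n.cast_nonneg (α := ℝ)])
  refine (((integrable_besselKernel n hs).const_mul (2 ^ (n + 1))).add
    (integrable_polyWeight.const_mul (C * 4 ^ (n + 1)))).mono'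
    ((measurable_besselKernel n s).mul (by fun_prop)).aestronglyMeasurable
    (ae_of_all _ fun z => ?_)
  have hG := besselKernel_nonneg n hs z
  have hw := polyWeight_pos z
  rw [Real.norm_of_nonneg (by positivity)]
  simp only [Pi.add_apply]
  rcases le_total ‖z‖ 1 with h | h
  · have h1 : (1 + ‖z‖) ^ (n + 1) ≤ 2 ^ (n + 1) := by gcongr; linarith
    have h2 : 0 ≤ C * 4 ^ (n + 1) * polyWeight n z := by positivity
    nlinarith
  · have hz : 0 < ‖z‖ := by linarith
    have h1 := hC z (norm_pos_iff.1 hz)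
    rw [Real.rpow_neg hz.le, Real.rpow_natCast] at h1
    have h2 : (‖z‖ ^ (2 * n + 2))⁻¹ * (1 + ‖z‖) ^ (n + 1) ≤ 4 ^ (n + 1) * polyWeight n z := by
      unfold polyWeight
      rw [inv_mul_eq_div, ← div_eq_mul_inv, div_le_div_iff₀ (by positivity) (by positivity),
        ← mul_pow, show 2 * n + 2 = 2 * (n + 1) by ring, pow_mul, ← mul_pow]
      exact pow_le_pow_left₀ (by positivity) (by nlinarith) _
    calc _ ≤ C * (‖z‖ ^ (2 * n + 2))⁻¹ * (1 + ‖z‖) ^ (n + 1) := by gcongr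
      _ ≤ C * (4 ^ (n + 1) * polyWeight n z) := by rw [mul_assoc]; gcongr
      _ ≤ _ := by
        have : 0 ≤ 2 ^ (n + 1) * besselKernel n s z := by positivity
        linarith

/-- Integrability over the product of the integrand of `∫ η (G_s * f)`. -/
theorem integrable_prod_besselKernel {s : ℝ} (hs : 0 < s) {f : EuclideanSpace ℝ (Fin n) → ℝ}
    (hf : AEStronglyMeasurable f) (hfw : Integrable fun y => f y * polyWeight n y)
    {η : EuclideanSpace ℝ (Fin n) → ℂ} (hη : Continuous η) {C : ℝ}
    (hηw : ∀ x, ‖η x‖ ≤ C * polyWeight n x) :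
    Integrable (fun p : EuclideanSpace ℝ (Fin n) × EuclideanSpace ℝ (Fin n) =>
      η p.1 * ((besselKernel n s (p.1 - p.2) * f p.2 : ℝ) : ℂ)) (volume.prod volume) := by
  have h1 := (hfw.norm.convolution_integrand (ContinuousLinearMap.mul ℝ ℝ)
    (integrable_besselKernel_mul_pow hs)).const_mul C
  refine h1.mono' ?_ (ae_of_all _ fun p => ?_)
  · have h2 : AEStronglyMeasurable (fun p : EuclideanSpace ℝ (Fin n) × EuclideanSpace ℝ (Fin n) =>
        besselKernel n s (p.1 - p.2) * f p.2) (volume.prod volume) :=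
      ((measurable_besselKernel n s).comp
        (measurable_fst.sub measurable_snd)).aestronglyMeasurable.mul hf.comp_snd
    exact (hη.comp continuous_fst).aestronglyMeasurable.mul
      (Complex.continuous_ofReal.comp_aestronglyMeasurable h2)
  · have hG := besselKernel_nonneg n hs (p.1 - p.2)
    have hw := polyWeight_pos p.2
    have hw1 := polyWeight_pos p.1
    have hC : 0 ≤ C := by
      have := (norm_nonneg _).trans (hηw p.1)
      by_contra! h
      nlinarith
    simp only [ContinuousLinearMap.mul_apply', norm_mul, Complex.norm_real,
      Real.norm_of_nonneg hG, Real.norm_of_nonneg hw.le]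
    calc ‖η p.1‖ * (besselKernel n s (p.1 - p.2) * ‖f p.2‖)
        ≤ (C * ((1 + ‖p.1 - p.2‖) ^ (n + 1) * polyWeight n p.2)) *
          (besselKernel n s (p.1 - p.2) * ‖f p.2‖) := by
          gcongr
          exact (hηw _).trans (mul_le_mul_of_nonneg_left (polyWeight_le _ _) hC)
      _ = _ := by ring

theorem ae_integrable_besselKernel_mul {s : ℝ} (hs : 0 < s)
    {f : EuclideanSpace ℝ (Fin n) → ℝ} (hf : AEStronglyMeasurable f)
    (hfw : Integrable fun y => f y * polyWeight n y) :
    ∀ᵐ x, Integrable fun y => besselKernel n s (x - y) * f y := by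
  have h := integrable_prod_besselKernel hs hf hfw (η := fun x => (polyWeight n x : ℂ)) (C := 1)
    (Complex.continuous_ofReal.comp continuous_polyWeight) fun x => by
      rw [Complex.norm_real, Real.norm_of_nonneg (polyWeight_pos x).le, one_mul]
  filter_upwards [h.prod_right_ae] with x hx
  have h0 : (polyWeight n x : ℂ) ≠ 0 := by exact_mod_cast (polyWeight_pos x).ne'
  have h1 := (hx.const_mul (polyWeight n x : ℂ)⁻¹).re
  refine h1.congr (ae_of_all _ fun y => ?_)
  simp only [RCLike.re_eq_complex_re]
  rw [inv_mul_cancel_left₀ h0, Complex.ofReal_re]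

theorem besselPotential_eq (s : ℝ) (f : EuclideanSpace ℝ (Fin n) → ℝ)
    (x : EuclideanSpace ℝ (Fin n)) :
    besselPotential n s f x = ∫ y, besselKernel n s (x - y) * f y := by
  rw [besselPotential, convolution_eq_swap]
  rfl

theorem integral_exp_mul_besselKernel {s : ℝ} (hs : 0 < s) (ξ : EuclideanSpace ℝ (Fin n)) :
    ∫ z, Complex.exp (((2 * Real.pi * inner ℝ ξ z : ℝ) : ℂ) * Complex.I) *
      (besselKernel n s z : ℂ) = (((1 + ‖(2 * Real.pi) • ξ‖ ^ 2) ^ (-s / 2) : ℝ) : ℂ) := by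
  have h := fourier_besselKernel n hs (-((2 * Real.pi) • ξ))
  rw [norm_neg] at h
  rw [← h]
  congr 1 with z
  rw [inner_neg_left, real_inner_smul_left]
  push_cast
  congr 2
  ring

/-- Convolution with the Bessel kernel is onto on the Schwartz space. -/
theorem exists_schwartz_besselKernel {s : ℝ} (hs : 0 < s) (φ : 𝓢(EuclideanSpace ℝ (Fin n), ℂ)) :
    ∃ ψ : 𝓢(EuclideanSpace ℝ (Fin n), ℂ),
      ∀ y, ∫ x, (besselKernel n s (x - y) : ℂ) * ψ x = φ y := by
  -- The inverse symbol of `G_s` in the `exp (2πi⟨ξ, x⟩)` normalization. It has temperate growth, so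
  -- multiplication by it preserves Schwartz functions.
  set m : EuclideanSpace ℝ (Fin n) → ℝ := fun ξ => (1 + ‖(2 * Real.pi) • ξ‖ ^ 2) ^ (s / 2) with hm
  have hmg : m.HasTemperateGrowth :=
    (Function.hasTemperateGrowth_one_add_norm_sq_rpow _ (s / 2)).comp
      (((2 * Real.pi) • ContinuousLinearMap.id ℝ (EuclideanSpace ℝ (Fin n))).hasTemperateGrowth)
  set g : 𝓢(EuclideanSpace ℝ (Fin n), ℂ) := smulLeftCLM ℂ m (𝓕 φ) with hg
  refine ⟨𝓕⁻ g, fun y => ?_⟩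
  have hgφ : ∀ ξ, g ξ = (m ξ : ℂ) * 𝓕 φ ξ := fun ξ => by
    rw [hg, smulLeftCLM_apply_apply hmg, Complex.real_smul]
  have hinv : ∀ x, (𝓕⁻ g) x = ∫ ξ, Complex.exp (((2 * Real.pi * inner ℝ ξ x : ℝ) : ℂ) *
      Complex.I) * g ξ := fun x => by
    rw [fourierInv_coe, Real.fourierInv_eq']; rfl
  have hinv' : φ y = ∫ ξ, Complex.exp (((2 * Real.pi * inner ℝ ξ y : ℝ) : ℂ) *
      Complex.I) * 𝓕 φ ξ := by
    have h : 𝓕⁻ (𝓕 φ) = φ := fourierInv_fourier_eq φ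
    conv_lhs => rw [← h]
    rw [fourierInv_coe, Real.fourierInv_eq']; rfl
  rw [← integral_add_right_eq_self _ y, hinv']
  simp only [add_sub_cancel_right, hinv]
  have hint : Integrable (Function.uncurry fun (z ξ : EuclideanSpace ℝ (Fin n)) =>
      (besselKernel n s z : ℂ) *
        (Complex.exp (((2 * Real.pi * inner ℝ ξ (z + y) : ℝ) : ℂ) * Complex.I) * g ξ))
      (volume.prod volume) := by
    have h1 := (integrable_besselKernel n hs).ofReal (𝕜 := ℂ) |>.mul_prod (g.integrable (μ := volume))
    have h2 := h1.bdd_mul (c := 1)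
      (f := fun p : EuclideanSpace ℝ (Fin n) × EuclideanSpace ℝ (Fin n) =>
        Complex.exp (((2 * Real.pi * inner ℝ p.2 (p.1 + y) : ℝ) : ℂ) * Complex.I))
      (Continuous.aestronglyMeasurable (by fun_prop))
      (ae_of_all _ fun p => (Complex.norm_exp_ofReal_mul_I _).le)
    refine h2.congr (ae_of_all _ fun p => ?_)
    simp only [Function.uncurry]
    change _ * ((besselKernel n s p.1 : ℂ) * g p.2) = _
    ring
  simp only [← integral_const_mul]
  rw [integral_integral_swap hint]
  congr 1 with ξ
  have hmξ : (m ξ : ℂ) * (((1 + ‖(2 * Real.pi) • ξ‖ ^ 2) ^ (-s / 2) : ℝ) : ℂ) = 1 := by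
    have h0 : 0 < 1 + ‖(2 * Real.pi) • ξ‖ ^ 2 := by positivity
    rw [← Complex.ofReal_mul, hm, ← Real.rpow_add h0]
    simp [neg_div]
  calc _ = ∫ z, (Complex.exp (((2 * Real.pi * inner ℝ ξ y : ℝ) : ℂ) * Complex.I) * g ξ) *
        (Complex.exp (((2 * Real.pi * inner ℝ ξ z : ℝ) : ℂ) * Complex.I) *
          (besselKernel n s z : ℂ)) := by
        congr 1 with z
        rw [inner_add_right, mul_add, Complex.ofReal_add, add_mul, Complex.exp_add]
        ring
    _ = _ := by
        rw [integral_const_mul, integral_exp_mul_besselKernel hs, hgφ]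
        linear_combination (Complex.exp (((2 * Real.pi * inner ℝ ξ y : ℝ) : ℂ) * Complex.I) *
          𝓕 φ ξ) * hmξ

/-- Write a test function `φ` as the Bessel potential of a Schwartz function `ψ`. By Fubini and
evenness of the kernel, `∫ φ f = ∫ ψ (G_s * f) = 0`. -/
theorem ae_eq_zero_of_besselPotential_ae_eq_zero {s : ℝ} (hs : 0 < s)
    {f : EuclideanSpace ℝ (Fin n) → ℝ} (hf : AEStronglyMeasurable f)
    (hfw : Integrable fun y => f y * polyWeight n y)
    (h0 : ∀ᵐ x, ∫ y, besselKernel n s (x - y) * f y = 0) : ∀ᵐ y, f y = 0 := by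
  have hloc : LocallyIntegrable f := by
    have h1 : LocallyIntegrable fun y => (1 + ‖y‖) ^ (n + 1) * (f y * polyWeight n y) := by
      have := hfw.locallyIntegrable
      rw [← locallyIntegrableOn_univ] at this ⊢
      exact this.continuousOn_mul (Continuous.continuousOn (by fun_prop)) isOpen_univ.isLocallyClosed
    refine h1.congr (ae_of_all _ fun y => ?_)
    simp only [polyWeight]
    have : (1 + ‖y‖) ^ (n + 1) ≠ 0 := by positivity
    field_simp
  refine ae_eq_zero_of_integral_contDiff_smul_eq_zero hloc fun φ hφ hφc => ?_
  have hφ' : ContDiff ℝ (⊤ : ℕ∞) fun y => (φ y : ℂ) := Complex.ofRealCLM.contDiff.comp hφ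
  have hφc' : HasCompactSupport fun y => (φ y : ℂ) := hφc.comp_left Complex.ofReal_zero
  obtain ⟨ψ, hψ⟩ := exists_schwartz_besselKernel (n := n) hs (hφc'.toSchwartzMap hφ')
  obtain ⟨C, hC⟩ : ∃ C : ℝ, ∀ x, ‖ψ x‖ ≤ C * polyWeight n x := by
    have h := SchwartzMap.one_add_le_sup_seminorm_apply (𝕜 := ℂ) (m := (n + 1, 0)) (k := n + 1)
      (n := 0) le_rfl le_rfl ψ
    refine ⟨2 ^ (n + 1) * ((Finset.Iic (n + 1, 0)).sup fun m => SchwartzMap.seminorm ℂ m.1 m.2) ψ,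
      fun x => ?_⟩
    have hx := h x
    rw [norm_iteratedFDeriv_zero] at hx
    rw [polyWeight, ← div_eq_mul_inv, le_div_iff₀ (by positivity), mul_comm]
    exact hx
  have hint := integrable_prod_besselKernel hs hf hfw ψ.continuous hC
  have key : ∫ y, ((φ y • f y : ℝ) : ℂ) = 0 := by
    calc ∫ y, ((φ y • f y : ℝ) : ℂ)
        = ∫ y, ∫ x, ψ x * ((besselKernel n s (x - y) * f y : ℝ) : ℂ) := by
          congr 1 with y
          have h1 := hψ y
          have h2 : hφc'.toSchwartzMap hφ' y = (φ y : ℂ) := rfl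
          rw [h2] at h1
          rw [smul_eq_mul, Complex.ofReal_mul, ← h1, ← integral_mul_const]
          congr 1 with x
          push_cast
          ring
      _ = ∫ x, ∫ y, ψ x * ((besselKernel n s (x - y) * f y : ℝ) : ℂ) :=
          (integral_integral_swap hint).symm
      _ = ∫ x : EuclideanSpace ℝ (Fin n), (0 : ℂ) := by
          refine integral_congr_ae ?_
          filter_upwards [h0] with x hx
          rw [integral_const_mul, integral_complex_ofReal, hx, Complex.ofReal_zero, mul_zero]
      _ = 0 := integral_zero _ _
  rw [integral_complex_ofReal] at key
  exact_mod_cast key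

/-- The density of a Bessel potential is unique. -/
theorem ae_eq_of_besselPotential_ae_eq {s : ℝ} (hs : 0 < s)
    {f g : EuclideanSpace ℝ (Fin n) → ℝ} (hf : AEStronglyMeasurable f)
    (hfw : Integrable fun y => f y * polyWeight n y) (hg : AEStronglyMeasurable g)
    (hgw : Integrable fun y => g y * polyWeight n y)
    (h : besselPotential n s f =ᵐ[volume] besselPotential n s g) : f =ᵐ[volume] g := by
  have h1 : ∀ᵐ y, (f - g) y = 0 := by
    refine ae_eq_zero_of_besselPotential_ae_eq_zero hs (hf.sub hg) ?_ ?_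
    · refine (hfw.sub hgw).congr (ae_of_all _ fun y => ?_)
      simp only [Pi.sub_apply, sub_mul]
    · filter_upwards [ae_integrable_besselKernel_mul hs hf hfw,
        ae_integrable_besselKernel_mul hs hg hgw, h] with x hfx hgx hx
      rw [besselPotential_eq, besselPotential_eq] at hx
      simp only [Pi.sub_apply, mul_sub]
      rw [integral_sub hfx hgx, hx, sub_self]
  filter_upwards [h1] with y hy
  simpa [sub_eq_zero] using hy

end Injectivity

/-! ### Orlicz spaces -/

section Orlicz

variable {n : ℕ} {A : ℝ → ℝ} {pm pp : ℝ}

theorem IsYoung.continuous_conj (hA : IsYoung A) : Continuous (conj A) := by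
  rw [← continuousOn_univ]; exact hA.convexOn_conj.continuousOn isOpen_univ

theorem IsYoung.lintegral_mul_le (hA : IsYoung A) (f : EuclideanSpace ℝ (Fin n) → ℝ)
    {k : EuclideanSpace ℝ (Fin n) → ℝ} (hk : Measurable k) (hk0 : ∀ y, 0 ≤ k y) :
    ∫⁻ y, ENNReal.ofReal (k y) * ‖f y‖ₑ ≤
      modular A f + ∫⁻ y, ENNReal.ofReal (conj A (k y)) := by
  rw [modular, ← lintegral_add_right _
    (by exact (hA.continuous_conj.measurable.comp hk).ennreal_ofReal)]
  refine lintegral_mono fun y => ?_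
  rw [Real.enorm_eq_ofReal_abs, ← ENNReal.ofReal_mul (hk0 y),
    ← ENNReal.ofReal_add (hA.nonneg (abs_nonneg _)) (hA.conj_nonneg (hk0 y)), mul_comm]
  exact ENNReal.ofReal_le_ofReal (hA.mul_le_add_conj (hk0 y) (abs_nonneg _))

theorem one_le_conjExponent {p : ℝ} (hp : 1 < p) : 1 ≤ p / (p - 1) := by
  rw [le_div_iff₀ (by linarith)]; linarith

/-- Young's inequality reduces this to integrability of `conj A (polyWeight n y)`. Since the weight
is at most `1` and both conjugate exponents are at least `1`, this is at most `2 * polyWeight n y *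
conj A 1`. -/
theorem MemOrlicz.integrable_mul_polyWeight (hA : IsYoung A) (hg : HasGrowth A pm pp)
    (hpm : 1 < pm) (hpp : pm ≤ pp) {f : EuclideanSpace ℝ (Fin n) → ℝ} (hf : MemOrlicz A f) :
    Integrable fun y => f y * polyWeight n y := by
  refine ⟨hf.1.mul continuous_polyWeight.aestronglyMeasurable, ?_⟩
  have h1 := hA.lintegral_mul_le f (k := polyWeight n) continuous_polyWeight.measurable
    fun y => (polyWeight_pos y).le
  have h2 : Integrable fun y => 2 * polyWeight n y * conj A 1 :=
    (integrable_polyWeight.const_mul 2).mul_const _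
  have h3 : ∫⁻ y, ENNReal.ofReal (conj A (polyWeight n y)) < ⊤ := by
    refine lt_of_le_of_lt (lintegral_mono fun y => ?_) h2.hasFiniteIntegral
    rw [Real.enorm_eq_ofReal_abs]
    refine ENNReal.ofReal_le_ofReal (le_trans ?_ (le_abs_self _))
    have hw := polyWeight_pos y
    have hw1 : polyWeight n y ≤ 1 := by
      unfold polyWeight
      exact inv_le_one_of_one_le₀ (one_le_pow₀ (by linarith [norm_nonneg y]))
    have hpow : ∀ q : ℝ, 1 ≤ q → polyWeight n y ^ q ≤ polyWeight n y := fun q hq => by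
      simpa using Real.rpow_le_rpow_of_exponent_ge hw hw1 hq
    have h4 := hA.conj_mul_le hg hpm hpp hw.le zero_le_one
    rw [mul_one] at h4
    refine h4.trans (mul_le_mul_of_nonneg_right ?_ (hA.conj_nonneg zero_le_one))
    linarith [hpow _ (one_le_conjExponent hpm), hpow _ (one_le_conjExponent (hpm.trans_le hpp))]
  refine lt_of_le_of_lt (lintegral_mono fun y => ?_)
    (h1.trans_lt (ENNReal.add_lt_top.2 ⟨hf.2, h3⟩))
  rw [enorm_mul, mul_comm, Real.enorm_of_nonneg (polyWeight_pos y).le]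

theorem MemOrlicz.exists_modular_div_le_one (hA : IsYoung A) (hg : HasGrowth A pm pp)
    (hpm : 1 < pm) {f : EuclideanSpace ℝ (Fin n) → ℝ} (hf : MemOrlicz A f) :
    ∃ l : ℝ, 0 < l ∧ modular A (fun x => f x / l) ≤ 1 := by
  set l := max 1 (modular A f).toReal with hl
  have hl1 : 1 ≤ l := le_max_left _ _
  have hl0 : 0 < l := by linarith
  refine ⟨l, hl0, ?_⟩
  calc modular A (fun x => f x / l) ≤ ∫⁻ x, ENNReal.ofReal l⁻¹ * ENNReal.ofReal (A |f x|) := by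
        refine lintegral_mono fun x => ?_
        rw [← ENNReal.ofReal_mul (by positivity), abs_div, abs_of_pos hl0]
        exact ENNReal.ofReal_le_ofReal (hA.div_le hg hpm hl1 (abs_nonneg _))
    _ = ENNReal.ofReal l⁻¹ * modular A f := lintegral_const_mul' _ _ ENNReal.ofReal_ne_top
    _ ≤ ENNReal.ofReal l⁻¹ * ENNReal.ofReal l := by
        gcongr
        rw [ENNReal.le_ofReal_iff_toReal_le hf.2.ne hl0.le]
        exact le_max_right _ _
    _ = 1 := by
        rw [← ENNReal.ofReal_mul (by positivity), inv_mul_cancel₀ hl0.ne', ENNReal.ofReal_one]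

theorem luxemburgNorm_congr {f g : EuclideanSpace ℝ (Fin n) → ℝ} (h : f =ᵐ[volume] g) :
    luxemburgNorm A f = luxemburgNorm A g := by
  have : ∀ l : ℝ, modular A (fun x => f x / l) = modular A (fun x => g x / l) := fun l =>
    lintegral_congr_ae (h.mono fun x hx => by simp only [hx])
  simp only [luxemburgNorm, this]

theorem IsDensity.ae_eq (hA : IsYoung A) (hg : HasGrowth A pm pp) (hpm : 1 < pm) (hpp : pm ≤ pp)
    {s : ℝ} (hs : 0 < s) {u f g : EuclideanSpace ℝ (Fin n) → ℝ} (hf : IsDensity s A u f)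
    (hg' : IsDensity s A u g) : f =ᵐ[volume] g :=
  ae_eq_of_besselPotential_ae_eq hs hf.1.1 (hf.1.integrable_mul_polyWeight hA hg hpm hpp)
    hg'.1.1 (hg'.1.integrable_mul_polyWeight hA hg hpm hpp) (hf.2.symm.trans hg'.2)

theorem IsDensity.besselOrliczNorm_eq (hA : IsYoung A) (hg : HasGrowth A pm pp) (hpm : 1 < pm)
    (hpp : pm ≤ pp) {s : ℝ} (hs : 0 < s) {u f : EuclideanSpace ℝ (Fin n) → ℝ}
    (hf : IsDensity s A u f) : besselOrliczNorm s A u = luxemburgNorm A f := by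
  have : {r : ℝ | ∃ f, IsDensity s A u f ∧ r = luxemburgNorm A f} = {luxemburgNorm A f} := by
    ext r
    constructor
    · rintro ⟨g, hg', rfl⟩
      exact luxemburgNorm_congr (hg'.ae_eq hA hg hpm hpp hs hf)
    · rintro rfl
      exact ⟨f, hf, rfl⟩
  rw [besselOrliczNorm, this, csInf_singleton]

theorem besselPotential_comp_isometry (s : ℝ) (f : EuclideanSpace ℝ (Fin n) → ℝ)
    (R : EuclideanSpace ℝ (Fin n) ≃ₗᵢ[ℝ] EuclideanSpace ℝ (Fin n))
    (x : EuclideanSpace ℝ (Fin n)) :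
    besselPotential n s (fun y => f (R y)) x = besselPotential n s f (R x) := by
  rw [besselPotential_eq, besselPotential_eq,
    ← R.measurePreserving.integral_comp R.toHomeomorph.measurableEmbedding
      (fun y => besselKernel n s (R x - y) * f y)]
  congr 1 with y
  rw [besselKernel_eq_of_norm_eq n s (y := R x - R y)]
  rw [← map_sub, R.norm_map]

/-- The density of a radial function is rotation invariant. -/
theorem IsDensity.comp_isometry_ae_eq (hA : IsYoung A) (hg : HasGrowth A pm pp) (hpm : 1 < pm)
    (hpp : pm ≤ pp) {s : ℝ} (hs : 0 < s) {u f : EuclideanSpace ℝ (Fin n) → ℝ}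
    (hf : IsDensity s A u f) (hu : IsRadial u)
    (R : EuclideanSpace ℝ (Fin n) ≃ₗᵢ[ℝ] EuclideanSpace ℝ (Fin n)) :
    (fun y => f (R y)) =ᵐ[volume] f := by
  obtain ⟨u₀, hu₀⟩ := hu
  have hR := R.measurePreserving
  have hw := hf.1.integrable_mul_polyWeight hA hg hpm hpp
  refine ae_eq_of_besselPotential_ae_eq hs (hf.1.1.comp_measurePreserving hR) ?_ hf.1.1 hw ?_
  · have h := (hR.integrable_comp_emb R.toHomeomorph.measurableEmbedding).2 hw
    refine h.congr (ae_of_all _ fun y => ?_)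
    simp only [Function.comp, polyWeight, R.norm_map]
  -- Almost everywhere `G_s * (f ∘ R) = (G_s * f) ∘ R = u ∘ R = u = G_s * f`, and uniqueness of
  -- densities applies.
  · filter_upwards [hu₀, hR.quasiMeasurePreserving.ae hu₀, hf.2,
      hR.quasiMeasurePreserving.ae hf.2] with x h1 h2 h3 h4
    rw [besselPotential_comp_isometry, ← h4, h2, ← h3, h1, R.norm_map]

/-! ### Young's inequality against the radial majorant -/

theorem zpow_one_sub {n : ℕ} (hn : 1 ≤ n) (r : ℝ) : r ^ (1 - (n : ℤ)) = (r ^ (n - 1))⁻¹ := by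
  rw [show (1 - (n : ℤ)) = -((n - 1 : ℕ) : ℤ) by omega, zpow_neg, zpow_natCast]

theorem norm_le_add_abs_norm_sub (y : EuclideanSpace ℝ (Fin n)) (r : ℝ) :
    ‖y‖ ≤ r + |‖y‖ - r| := by
  linarith [le_abs_self (‖y‖ - r)]

/-- With `h = |‖y‖ - r|`, the factor `k * (r / (r + h)) ^ (n - 1)` is at most `1`, so its `q`-th
power is at most itself. Only `decay` keeps the exponent `q`, and `‖y‖ ≤ r + h` yields the weight
that cancels the polar Jacobian. -/
theorem rpow_mul_radialMajorant_le {σ r k q : ℝ} (hr : 0 < r) (hk0 : 0 ≤ k)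
    (hk1 : k ≤ 1) (hq : 1 ≤ q) {y : EuclideanSpace ℝ (Fin n)} (hy : y ≠ 0) :
    (k * radialMajorant n σ r y * r ^ (n - 1)) ^ q * (r ^ (n - 1))⁻¹ ≤
      k * ((‖y‖ ^ (n - 1))⁻¹ * decay σ |‖y‖ - r| ^ q) := by
  have hy0 : 0 < ‖y‖ := norm_pos_iff.2 hy
  set h := |‖y‖ - r| with hh
  have hh0 : 0 ≤ h := abs_nonneg _
  have hyr : ‖y‖ ≤ r + h := norm_le_add_abs_norm_sub y r
  have hd := decay_nonneg σ hh0
  have e : k * radialMajorant n σ r y * r ^ (n - 1) =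
      (k * (r / (r + h)) ^ (n - 1)) * decay σ h := by
    rw [radialMajorant, ← hh, div_pow]; ring
  have h1 : (r / (r + h)) ^ (n - 1) ≤ 1 :=
    pow_le_one₀ (by positivity) (by rw [div_le_one (by positivity)]; linarith)
  have h0 : 0 ≤ k * (r / (r + h)) ^ (n - 1) := by positivity
  have h2 : (k * (r / (r + h)) ^ (n - 1)) ^ q ≤ k * (r / (r + h)) ^ (n - 1) := by
    simpa using Real.rpow_le_rpow_of_exponent_ge_of_imp h0 (mul_le_one₀ hk1 (by positivity) h1) hq
      (fun _ h => by linarith)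
  rw [e, Real.mul_rpow h0 hd]
  calc _ ≤ (k * (r / (r + h)) ^ (n - 1)) * decay σ h ^ q * (r ^ (n - 1))⁻¹ := by gcongr
    _ = k * (((r + h) ^ (n - 1))⁻¹ * decay σ h ^ q) := by rw [div_pow]; field_simp
    _ ≤ _ := by gcongr

theorem IsYoung.conj_radialMajorant_le (hA : IsYoung A) (hg : HasGrowth A pm pp) (hpm : 1 < pm)
    (hpp : pm ≤ pp) {σ r k T : ℝ} (hr : 0 < r) (hk0 : 0 ≤ k) (hk1 : k ≤ 1)
    (hT : 0 ≤ T) (hTr : conj A T = (r ^ (n - 1))⁻¹) {y : EuclideanSpace ℝ (Fin n)}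
    (hy : y ≠ 0) :
    conj A (k * radialMajorant n σ r y * r ^ (n - 1) * T) ≤
      k * ((‖y‖ ^ (n - 1))⁻¹ * decay σ |‖y‖ - r| ^ (pp / (pp - 1))) +
        k * ((‖y‖ ^ (n - 1))⁻¹ * decay σ |‖y‖ - r| ^ (pm / (pm - 1))) := by
  have hR := radialMajorant_nonneg n σ hr.le y
  refine (hA.conj_mul_le hg hpm hpp (by positivity) hT).trans ?_
  rw [hTr, add_mul]
  exact add_le_add
    (rpow_mul_radialMajorant_le hr hk0 hk1 (one_le_conjExponent (hpm.trans_le hpp)) hy)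
    (rpow_mul_radialMajorant_le hr hk0 hk1 (one_le_conjExponent hpm) hy)

theorem one_sub_mul_conjExponent_lt {σ p : ℝ} (hp : 1 < p) (hσ : 1 < σ * p) :
    (1 - σ) * (p / (p - 1)) < 1 := by
  rw [← mul_div_assoc, div_lt_one (by linarith)]; linarith

/-- The pointwise estimate for potentials of rotation invariant functions. -/
theorem exists_lintegral_besselKernel_le (hn : 1 ≤ n) {s : ℝ} (hpm : 1 < pm) (hpp : pm ≤ pp)
    (hs : 1 < s * pm) :
    ∃ C : ℝ, 0 < C ∧ ∀ A : ℝ → ℝ, IsYoung A → HasGrowth A pm pp →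
      ∀ f : EuclideanSpace ℝ (Fin n) → ℝ, AEStronglyMeasurable f →
        (∀ R : EuclideanSpace ℝ (Fin n) ≃ₗᵢ[ℝ] EuclideanSpace ℝ (Fin n),
          (fun y => f (R y)) =ᵐ[volume] f) →
        ∀ l : ℝ, 0 < l → modular A (fun y => f y / l) ≤ 1 →
          ∀ x : EuclideanSpace ℝ (Fin n), x ≠ 0 →
            ∫⁻ y, ENNReal.ofReal (besselKernel n s (x - y)) * ‖f y‖ₑ ≤
              ENNReal.ofReal (C * (‖x‖ ^ (1 - (n : ℤ)) /
                invHalfLine (conj A) (‖x‖ ^ (1 - (n : ℤ)))) * l) := by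
  have hpm0 : 0 < pm := by linarith
  -- `σ > 1 / pm` makes the decay integrals converge at the conjugate exponents of both `pm` and
  -- `pp`; `σ < s` gives the kernel bound, and `σ < 1` the convergence of the integrals in `t`.
  obtain ⟨σ, hσ, hσ'⟩ : ∃ σ, 1 / pm < σ ∧ σ < min 1 s := by
    refine exists_between (lt_min ?_ ?_)
    · rw [div_lt_one hpm0]; exact hpm
    · rw [div_lt_iff₀ hpm0]; exact hs
  have hσ0 : 0 < σ := lt_trans (by positivity) hσ
  have hσ1 : σ < 1 := hσ'.trans_le (min_le_left _ _)
  have hσs : σ < s := hσ'.trans_le (min_le_right _ _)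
  have hσm : 1 < σ * pm := by rwa [div_lt_iff₀ hpm0] at hσ
  have hσp : 1 < σ * pp := hσm.trans_le (by gcongr)
  obtain ⟨C₁, hC₁, hC⟩ := lintegral_besselKernel_mul_le hn (hσ0.trans hσs) hσ0 hσ1 hσs
  obtain ⟨D₁, hD₁, hD₁'⟩ := lintegral_decay_rpow_le hn (one_le_conjExponent (hpm.trans_le hpp))
    (one_sub_mul_conjExponent_lt (hpm.trans_le hpp) hσp)
  obtain ⟨D₂, hD₂, hD₂'⟩ := lintegral_decay_rpow_le hn (one_le_conjExponent hpm)
    (one_sub_mul_conjExponent_lt hpm hσm)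
  -- Small enough that the `conj A`-modular of the scaled majorant is at most `1`; `+ 1` keeps `k`
  -- defined and at most `1` even when `D₁` and `D₂` vanish.
  set k : ℝ := (D₁ + D₂ + 1)⁻¹ with hk
  have hk0 : 0 < k := by positivity
  have hk1 : k ≤ 1 := inv_le_one_of_one_le₀ (by linarith)
  refine ⟨(C₁ + 1) * (2 / k), by positivity, fun A hA hg f hf hinv l hl hfl x hx => ?_⟩
  have hr : 0 < ‖x‖ := norm_pos_iff.2 hx
  rw [zpow_one_sub hn]
  set r := ‖x‖ with hr'
  obtain ⟨hT, hTr⟩ := hA.conj_invHalfLine (show 0 < (r ^ (n - 1))⁻¹ by positivity)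
  set T := invHalfLine (conj A) (r ^ (n - 1))⁻¹
  have hkernel : ∫⁻ y, ENNReal.ofReal (besselKernel n s (x - y)) * ‖f y‖ₑ ≤
      ENNReal.ofReal C₁ * ∫⁻ y, ENNReal.ofReal (radialMajorant n σ r y) * ‖f y‖ₑ := by
    have hmk := hf.ae_eq_mk
    have h := hC (fun y => ‖hf.mk f y‖ₑ) hf.stronglyMeasurable_mk.enorm (fun R => by
      filter_upwards [hinv R, hmk, R.measurePreserving.quasiMeasurePreserving.ae hmk]
        with y h1 h2 h3
      rw [← h3, h1, h2]) x hx
    refine le_trans (le_of_eq ?_) (h.trans (le_of_eq ?_))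
    · exact lintegral_congr_ae (hmk.mono fun y hy => by simp only [← hy])
    · congr 1
      exact lintegral_congr_ae (hmk.mono fun y hy => by simp only [← hy, hr'])
  have hconj : ∫⁻ y : EuclideanSpace ℝ (Fin n),
      ENNReal.ofReal (conj A (k * radialMajorant n σ r y * r ^ (n - 1) * T)) ≤ 1 := by
    have hm : ∀ q : ℝ, Measurable fun y : EuclideanSpace ℝ (Fin n) =>
        ENNReal.ofReal ((‖y‖ ^ (n - 1))⁻¹ * decay σ |‖y‖ - r| ^ q) := fun q => by
      have := measurable_decay σ
      fun_prop
    have hnn : ∀ (q : ℝ) (y : EuclideanSpace ℝ (Fin n)),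
        0 ≤ (‖y‖ ^ (n - 1))⁻¹ * decay σ |‖y‖ - r| ^ q := fun q y => by
      have := decay_nonneg σ (abs_nonneg (‖y‖ - r))
      positivity
    calc _ ≤ ∫⁻ y : EuclideanSpace ℝ (Fin n), (ENNReal.ofReal k *
            ENNReal.ofReal ((‖y‖ ^ (n - 1))⁻¹ * decay σ |‖y‖ - r| ^ (pp / (pp - 1))) +
          ENNReal.ofReal k *
            ENNReal.ofReal ((‖y‖ ^ (n - 1))⁻¹ * decay σ |‖y‖ - r| ^ (pm / (pm - 1)))) := by
          refine lintegral_mono_ae ?_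
          filter_upwards [ae_ne hn 0] with y hy
          rw [← ENNReal.ofReal_mul hk0.le, ← ENNReal.ofReal_mul hk0.le,
            ← ENNReal.ofReal_add (mul_nonneg hk0.le (hnn _ _)) (mul_nonneg hk0.le (hnn _ _))]
          exact ENNReal.ofReal_le_ofReal
            (hA.conj_radialMajorant_le hg hpm hpp hr hk0.le hk1 hT.le hTr hy)
      _ ≤ ENNReal.ofReal k * ENNReal.ofReal D₁ + ENNReal.ofReal k * ENNReal.ofReal D₂ := by
          rw [lintegral_add_left ((hm _).const_mul _), lintegral_const_mul _ (hm _),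
            lintegral_const_mul _ (hm _)]
          gcongr
          · exact hD₁' r hr
          · exact hD₂' r hr
      _ ≤ 1 := by
          rw [← mul_add, ← ENNReal.ofReal_add hD₁ hD₂, ← ENNReal.ofReal_mul hk0.le,
            ENNReal.ofReal_le_one, hk, inv_mul_eq_div, div_le_one (by positivity)]
          linarith
  -- The prefactor undoes the scaling by `k * r ^ (n - 1) * T` and by `1 / l`; after scaling, each
  -- of the two modulars in Young's inequality is at most `1`, whence the `2`.
  have hyoung : ∫⁻ y, ENNReal.ofReal (radialMajorant n σ r y) * ‖f y‖ₑ ≤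
      ENNReal.ofReal (l * ((r ^ (n - 1))⁻¹ / T) / k) * 2 := by
    have h1 := hA.lintegral_mul_le (fun y => f y / l)
      (k := fun y => k * radialMajorant n σ r y * r ^ (n - 1) * T)
      ((((measurable_radialMajorant n σ r).const_mul k).mul_const _).mul_const _) fun y => by
        have := radialMajorant_nonneg n σ hr.le y
        positivity
    calc _ = ∫⁻ y, ENNReal.ofReal (l * ((r ^ (n - 1))⁻¹ / T) / k) *
          (ENNReal.ofReal (k * radialMajorant n σ r y * r ^ (n - 1) * T) * ‖f y / l‖ₑ) := by
          refine lintegral_congr fun y => ?_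
          have := radialMajorant_nonneg n σ hr.le y
          rw [Real.enorm_eq_ofReal_abs, Real.enorm_eq_ofReal_abs, ← ENNReal.ofReal_mul this,
            ← ENNReal.ofReal_mul (by positivity), ← ENNReal.ofReal_mul (by positivity),
            abs_div, abs_of_pos hl]
          congr 1
          field_simp
      _ = ENNReal.ofReal (l * ((r ^ (n - 1))⁻¹ / T) / k) * ∫⁻ y,
          ENNReal.ofReal (k * radialMajorant n σ r y * r ^ (n - 1) * T) * ‖f y / l‖ₑ :=
          lintegral_const_mul' _ _ ENNReal.ofReal_ne_top
      _ ≤ _ := by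
          gcongr
          calc _ ≤ _ := h1
            _ ≤ 1 + 1 := add_le_add hfl hconj
            _ = 2 := one_add_one_eq_two
  refine hkernel.trans ((mul_le_mul_right hyoung _).trans ?_)
  rw [show (2 : ENNReal) = ENNReal.ofReal 2 by simp, ← ENNReal.ofReal_mul (by positivity),
    ← ENNReal.ofReal_mul hC₁]
  refine ENNReal.ofReal_le_ofReal ?_
  calc _ = C₁ * (2 / k) * ((r ^ (n - 1))⁻¹ / T) * l := by ring
    _ ≤ _ := by gcongr; linarith

end Orlicz

end OrliczBessel

end

/-! ### The Strauss-type bound -/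

theorem mainTheorem6 (n : ℕ) (hn : 1 ≤ n) (s pm pp : ℝ) (hpm : 1 < pm) (hpp : pm ≤ pp)
    (hs : 1 < s * pm) :
    ∃ C : ℝ, 0 < C ∧
      ∀ A : ℝ → ℝ, OrliczBessel.IsYoung A →
        OrliczBessel.DeltaTwo A → OrliczBessel.DeltaTwo (OrliczBessel.conj A) →
        OrliczBessel.HasGrowth A pm pp →
        ∀ u : EuclideanSpace ℝ (Fin n) → ℝ,
          OrliczBessel.MemBesselOrlicz s A u → OrliczBessel.IsRadial u →
          (∀ᵐ x, |u x| ≤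
            C * (‖x‖ ^ (1 - (n : ℤ)) /
                OrliczBessel.invHalfLine (OrliczBessel.conj A) (‖x‖ ^ (1 - (n : ℤ)))) *
              OrliczBessel.besselOrliczNorm s A u) ∧
          ∀ f : EuclideanSpace ℝ (Fin n) → ℝ, OrliczBessel.IsDensity s A u f →
            ∀ x : EuclideanSpace ℝ (Fin n), x ≠ 0 →
              ConvolutionExistsAt (OrliczBessel.besselKernel n s) f x
                (ContinuousLinearMap.mul ℝ ℝ) volume ∧
              |OrliczBessel.besselPotential n s f x| ≤
                C * (‖x‖ ^ (1 - (n : ℤ)) /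
                    OrliczBessel.invHalfLine (OrliczBessel.conj A) (‖x‖ ^ (1 - (n : ℤ)))) *
                  OrliczBessel.besselOrliczNorm s A u := by
  have hs0 : 0 < s := by
    by_contra! h
    nlinarith
  obtain ⟨C, hC0, hC⟩ := OrliczBessel.exists_lintegral_besselKernel_le hn hpm hpp hs
  refine ⟨C, hC0, fun A hA _ _ hg u hu hrad => ?_⟩
  have main : ∀ f : EuclideanSpace ℝ (Fin n) → ℝ, OrliczBessel.IsDensity s A u f →
      ∀ x : EuclideanSpace ℝ (Fin n), x ≠ 0 →
        ConvolutionExistsAt (OrliczBessel.besselKernel n s) f x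
          (ContinuousLinearMap.mul ℝ ℝ) volume ∧
        |OrliczBessel.besselPotential n s f x| ≤
          C * (‖x‖ ^ (1 - (n : ℤ)) /
              OrliczBessel.invHalfLine (OrliczBessel.conj A) (‖x‖ ^ (1 - (n : ℤ)))) *
            OrliczBessel.besselOrliczNorm s A u := by
    intro f hf x hx
    have hr : 0 < ‖x‖ := norm_pos_iff.2 hx
    set μ := ‖x‖ ^ (1 - (n : ℤ)) /
      OrliczBessel.invHalfLine (OrliczBessel.conj A) (‖x‖ ^ (1 - (n : ℤ))) with hμ
    have hμ0 : 0 < μ := div_pos (zpow_pos hr _) (hA.conj_invHalfLine (zpow_pos hr _)).1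
    have hbound : ∀ l : ℝ, 0 < l → OrliczBessel.modular A (fun y => f y / l) ≤ 1 →
        ∫⁻ y, ‖OrliczBessel.besselKernel n s (x - y) * f y‖ₑ ≤ ENNReal.ofReal (C * μ * l) := by
      intro l hl hfl
      have h := hC A hA hg f hf.1.1 (hf.comp_isometry_ae_eq hA hg hpm hpp hs0 hrad) l hl hfl x hx
      simp_rw [enorm_mul, Real.enorm_of_nonneg (OrliczBessel.besselKernel_nonneg n hs0 _)]
      exact h
    obtain ⟨l₀, hl₀, hfl₀⟩ := hf.1.exists_modular_div_le_one hA hg hpm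
    refine ⟨?_, ?_⟩
    · rw [convolutionExistsAt_iff_integrable_swap]
      refine ⟨?_, (hbound l₀ hl₀ hfl₀).trans_lt ENNReal.ofReal_lt_top⟩
      exact ((OrliczBessel.measurable_besselKernel n s).comp
        (measurable_const.sub measurable_id)).aestronglyMeasurable.mul hf.1.1
    · rw [hf.besselOrliczNorm_eq hA hg hpm hpp hs0, OrliczBessel.besselPotential_eq,
        ← div_le_iff₀' (by positivity)]
      -- The estimate holds with every admissible `l` in place of the norm, so it passes to the
      -- infimum; `l₀` shows that the set is nonempty.
      refine le_csInf ⟨l₀, hl₀, hfl₀⟩ fun l hl => ?_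
      rw [div_le_iff₀' (by positivity)]
      have h := (enorm_integral_le_lintegral_enorm _).trans (hbound l hl.1 hl.2)
      rw [Real.enorm_eq_ofReal_abs] at h
      have hl0 := hl.1
      exact (ENNReal.ofReal_le_ofReal_iff (by positivity)).1 h
  refine ⟨?_, main⟩
  obtain ⟨f, hf⟩ := hu.2
  filter_upwards [hf.2, OrliczBessel.ae_ne hn 0] with x hux hx
  rw [hux]
  exact (main f hf x hx).2
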